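/- Let $F:\mathbb{R}\to\mathbb{R}$ be an increasing real-analytic diffeomorphism such that $F-\mathrm{Id}$ is $1$-periodic, and for $t\in\mathbb{R}$ put $F_t(x)=F(x)+t$. For such a map $G$ let $\mathrm{Trans}(G)=\lim_{n\to\infty}\frac{G^{\circ n}(x)-x}{n}$ be its translation number (the limit exists and does not depend on $x$). Assume that $\theta:=\mathrm{Trans}(F)$ is irrational. Let $\Phi_F:\mathbb{R}\to\mathbb{R}$ be the linearizing map $$\Phi_F(x)=\lim_{N\to\infty}\frac1N\sum_{k=0}^{N-1}\bigl(F^{\circ k}(x)-k\theta\bigr),$$ an increasing homeomorphism with $\Phi_F\circ F=\Phi_F+\theta$, and let $\Psi_F=\Phi_F^{-1}$. Assume that $F$ has a Herman ring of modulus $2\tau$ with $0<\tau\le\infty$, that is, $\tau$ is the largest element of $(0,\infty]$ such that $\Psi_F$ extends to an injective holomorphic map on the strip $\{z\in\mathbb{C}: |\mathrm{Im}\, z|<\tau\}$. For $n\ge 0$ let $p_n/q_n$ (in lowest terms, $q_n>0$) be the $n$-th convergent of the continued fraction of $\theta$, and let $\ell_{p_n/q_n}$ be the length of the interval $\{t\in\mathbb{R}:\mathrm{Trans}(F_t)=p_n/q_n\}$.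 Then $$\limsup_{n\to\infty}\frac{1}{q_n}\log \ell_{p_n/q_n}\le -2\pi\tau,$$ with the conventions $\log 0=-\infty$ and $-2\pi\cdot\infty=-\infty$. -/

import Mathlib

open Filter Topology MeasureTheory
open scoped ENNReal

noncomputable section

/-- The translated map `F_t(x) = F(x) + t`.  An element `F` of Mathlib's type `CircleDeg1Lift` is a
monotone map `ℝ → ℝ` with `F (x + 1) = F x + 1`, and `CircleDeg1Lift.translationNumber F` is
`Trans(F) = lim (F^n(x) - x) / n`. -/
def translatedMap (F : CircleDeg1Lift) (t : ℝ) : CircleDeg1Lift where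
  toFun x := F x + t
  monotone' _ _ h := add_le_add_left (F.monotone h) t
  map_add_one' x := by rw [F.map_add_one]; ring

/-- The set of parameters `I(θ) = {t ∈ ℝ | Trans(F_t) = θ}`. -/
def paramInterval (F : CircleDeg1Lift) (θ : ℝ) : Set ℝ :=
  {t : ℝ | (translatedMap F t).translationNumber = θ}

/-- The length `ℓ_θ` of the interval `I(θ)`, that is, its Lebesgue measure. -/
def paramLength (F : CircleDeg1Lift) (θ : ℝ) : ℝ≥0∞ :=
  volume (paramInterval F θ)

/-- `Φ` is the linearizing map `Φ_F` of `F`: with `α = Trans(F)`, it is the pointwise limit of the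
averages `(1 / N) ∑_{k < N} (F^k(x) - k α)`. -/
def IsLinearizingMap (F : CircleDeg1Lift) (Φ : ℝ → ℝ) : Prop :=
  ∀ x : ℝ, Tendsto
    (fun N : ℕ => (1 / (N : ℝ)) * ∑ k ∈ Finset.range N, (F^[k] x - k * F.translationNumber))
    atTop (𝓝 (Φ x))

/-- The open strip `S(τ) = {z ∈ ℂ | -τ < Im z < τ}`, where `0 ≤ τ ≤ ∞`. -/
def openStrip (τ : ℝ≥0∞) : Set ℂ :=
  {z : ℂ | ENNReal.ofReal |z.im| < τ}

/-- The inverse `Ψ_F` of the linearizing map `Φ_F` extends univalently (as an injective holomorphic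
map) to the strip `S(τ)`.  The values of the extension on the real line are prescribed by
`Ψ (Φ_F x) = x`. -/
def InverseExtendsUnivalently (F : CircleDeg1Lift) (τ : ℝ≥0∞) : Prop :=
  ∃ Φ : ℝ → ℝ, IsLinearizingMap F Φ ∧ Function.Bijective Φ ∧
    ∃ Ψ : ℂ → ℂ, DifferentiableOn ℂ Ψ (openStrip τ) ∧ Set.InjOn Ψ (openStrip τ) ∧
      ∀ x : ℝ, Ψ (Φ x : ℂ) = (x : ℂ)

/-- The modulus of the Herman ring of `F`: twice the largest `τ` such that `Ψ_F` extends univalently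
to `S(τ)`.  It is `0` if there is no Herman ring, and `∞` if `Ψ_F` extends univalently to `ℂ`. -/
def hermanModulus (F : CircleDeg1Lift) : ℝ≥0∞ :=
  2 * sSup {τ : ℝ≥0∞ | InverseExtendsUnivalently F τ}

end

/-! The map `Ψ` conjugates $F$ to the rotation $w\mapsto w+\theta$ on each strip
$|\mathrm{Im}\,w|<\sigma$, $\sigma<\tau$. Hence it conjugates $F+t$, for small complex $t$, to
$w\mapsto w+\theta+g(w,t)$ with $g(w,t)=t\,h(w)+O(t^2)$ and $\mathrm{Re}\,h\ge c>0$ on the real line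
(`exists_isRotationPerturbation`). Let $p/q$ be a convergent, so $|\theta-p/q|\le 1/q^2$. If $F_t$
has translation number $p/q$, some real $x$ satisfies $F_t^{\circ q}(x)=x+p$, and this forces
$t=O(1/q^2)$ (`abs_le_of_iterate_eq`).

The closing equation also makes sense for complex base points. After $q$ steps $w$ has moved by
about $q\theta+tqA$, where $A$ is a nearly constant, nonzero average of $h$. So exactly one small
parameter $T(w)$ closes the orbit, and it is holomorphic in $w$ (`exists_closing_parameter`).

A closed orbit may be started at any of its points, so $T$ is invariant under
$R(w)=w+\theta+g(w,T(w))$ as well as under $w+1$. Averaging along the orbit gives a coordinate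
$\Lambda$, within $O(1/q)$ of the identity, in which $R$ is translation by $p/q$. There $T$ has
periods $1$ and $p/q$, hence $1/q$: only frequencies divisible by $q$ survive, and near the real
line $T$ is exponentially close to a constant (`exists_norm_closing_parameter_sub_le`). The $O(1/q)$
loss of width costs a bounded factor only. Thus all parameters with translation number $p/q$ lie
within $Ce^{-2\pi q\sigma}$ of one number, and $\sigma$ may tend to $\tau$. -/

/-! ### Horizontal strips -/

/-- The horizontal strip of half-width `σ` around the real axis. -/
def horizontalStrip (σ : ℝ) : Set ℂ := {z : ℂ | |z.im| < σ}

theorem mem_horizontalStrip {σ : ℝ} {z : ℂ} : z ∈ horizontalStrip σ ↔ |z.im| < σ := Iff.rfl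

theorem isOpen_horizontalStrip (σ : ℝ) : IsOpen (horizontalStrip σ) :=
  isOpen_lt (Complex.continuous_im.abs) continuous_const

theorem horizontalStrip_mono {σ σ' : ℝ} (h : σ ≤ σ') : horizontalStrip σ ⊆ horizontalStrip σ' :=
  fun _ hz => lt_of_lt_of_le hz h

theorem convex_horizontalStrip (σ : ℝ) : Convex ℝ (horizontalStrip σ) := by
  have : horizontalStrip σ = Complex.imLm ⁻¹' (Set.Ioo (-σ) σ) := by
    ext z; simp [horizontalStrip, abs_lt]
  rw [this]
  exact (convex_Ioo _ _).linear_preimage _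

theorem ofReal_mem_horizontalStrip {σ : ℝ} (h : 0 < σ) (x : ℝ) : (x : ℂ) ∈ horizontalStrip σ := by
  simpa [horizontalStrip] using h

theorem add_mem_horizontalStrip {σ δ : ℝ} {z w : ℂ} (hz : z ∈ horizontalStrip σ) (hw : ‖w‖ ≤ δ) :
    z + w ∈ horizontalStrip (σ + δ) := by
  rw [mem_horizontalStrip, Complex.add_im]
  have := (Complex.abs_im_le_norm w).trans hw
  have := abs_add_le z.im w.im
  have h3 := mem_horizontalStrip.1 hz
  linarith

theorem add_ofReal_mem_horizontalStrip {σ : ℝ} {z : ℂ} (hz : z ∈ horizontalStrip σ) (x : ℝ) :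
    z + x ∈ horizontalStrip σ := by
  simpa [horizontalStrip] using hz

/-! ### Holomorphic inverses and fixed points -/

/-- Injectivity excludes local constancy, so $f$ is open and its inverse continuous. The inverse is
differentiable where $f'\ne0$; zeros of $f'$ are isolated, and continuity makes their images
removable singularities. -/
theorem exists_differentiableOn_leftInverse {f : ℂ → ℂ} {U : Set ℂ}
    (hU : IsOpen U) (hc : IsPreconnected U) (hf : DifferentiableOn ℂ f U) (hinj : Set.InjOn f U) :
    IsOpen (f '' U) ∧ ∃ g : ℂ → ℂ, DifferentiableOn ℂ g (f '' U) ∧ ∀ z ∈ U, g (f z) = z := by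
  have han : AnalyticOnNhd ℂ f U := hf.analyticOnNhd hU
  have hloc : ∀ z ∈ U, ¬ ∀ᶠ w in 𝓝 z, f w = f z := by
    intro z hz hev
    have h1 : ∀ᶠ w in 𝓝[≠] z, f w = f z ∧ w ∈ U :=
      (hev.and (hU.mem_nhds hz)).filter_mono nhdsWithin_le_nhds
    obtain ⟨w, ⟨hw1, hw2⟩, hw3⟩ := (h1.and self_mem_nhdsWithin).exists
    exact hw3 (hinj hw2 hz hw1)
  have hopen : ∀ s ⊆ U, IsOpen s → IsOpen (f '' s) := by
    rcases han.is_constant_or_isOpen hc with ⟨w, hw⟩ | h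
    · intro s hs _
      by_cases hne : U.Nonempty
      · obtain ⟨z, hz⟩ := hne
        exact absurd (by filter_upwards [hU.mem_nhds hz] with y hy; rw [hw y hy, hw z hz]) (hloc z hz)
      · rw [Set.not_nonempty_iff_eq_empty] at hne
        have : s = ∅ := Set.subset_empty_iff.1 (hne ▸ hs)
        simp [this]
    · exact h
  refine ⟨hopen U subset_rfl hU, ?_⟩
  let g := Function.invFunOn f U
  have hleft : ∀ z ∈ U, g (f z) = z := fun z hz => hinj.leftInvOn_invFunOn hz
  refine ⟨g, ?_, hleft⟩
  have hcont : ∀ z ∈ U, ContinuousAt g (f z) := by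
    intro z hz
    rw [ContinuousAt, hleft z hz]
    intro V hV
    obtain ⟨W, hWV, hWo, hzW⟩ := mem_nhds_iff.1 (inter_mem hV (hU.mem_nhds hz))
    have h1 : f '' W ∈ 𝓝 (f z) :=
      (hopen W (fun x hx => (hWV hx).2) hWo).mem_nhds ⟨z, hzW, rfl⟩
    refine mem_map.2 (mem_of_superset h1 ?_)
    rintro _ ⟨w, hw, rfl⟩
    simpa [hleft w (hWV hw).2] using (hWV hw).1
  have hright : ∀ z ∈ U, ∀ᶠ y in 𝓝 (f z), f (g y) = y := by
    intro z hz
    filter_upwards [(hopen U subset_rfl hU).mem_nhds ⟨z, hz, rfl⟩]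
    rintro _ ⟨w, hw, rfl⟩
    rw [hleft w hw]
  have hgood : ∀ z ∈ U, deriv f z ≠ 0 → DifferentiableAt ℂ g (f z) := by
    intro z hz hd
    have h1 : HasDerivAt f (deriv f z) (g (f z)) := by
      rw [hleft z hz]; exact (hf.differentiableAt (hU.mem_nhds hz)).hasDerivAt
    exact (h1.of_local_left_inverse (hcont z hz) hd (hright z hz)).differentiableAt
  rintro _ ⟨z, hz, rfl⟩
  apply DifferentiableAt.differentiableWithinAt
  have hder : AnalyticAt ℂ (deriv f) z := (han z hz).deriv
  rcases hder.eventually_eq_zero_or_eventually_ne_zero with h0 | h1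
  · exfalso
    apply hloc z hz
    obtain ⟨ε, hε, hball⟩ := Metric.eventually_nhds_iff_ball.1 (h0.and (hU.mem_nhds hz))
    filter_upwards [Metric.ball_mem_nhds z hε] with w hw
    refine (convex_ball z ε).is_const_of_fderivWithin_eq_zero (𝕜 := ℂ) (f := f) ?_ ?_ hw (Metric.mem_ball_self hε)
    · exact hf.mono fun y hy => (hball y hy).2
    · intro y hy
      rw [fderivWithin_of_isOpen Metric.isOpen_ball hy]
      ext
      simpa using (hball y hy).1
  · refine (Complex.analyticAt_of_differentiable_on_punctured_nhds_of_continuousAt ?_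
      (hcont z hz)).differentiableAt
    have ht : Tendsto g (𝓝[≠] (f z)) (𝓝[≠] z) := by
      refine tendsto_nhdsWithin_iff.2 ⟨?_, ?_⟩
      · have := hcont z hz
        rw [ContinuousAt, hleft z hz] at this
        exact this.mono_left nhdsWithin_le_nhds
      · filter_upwards [(hright z hz).filter_mono nhdsWithin_le_nhds, self_mem_nhdsWithin] with y hy hne h
        apply hne
        simp only [Set.mem_singleton_iff] at h ⊢
        rw [← hy, h]
    have ht2 := ht.eventually (h1.and (nhdsWithin_le_nhds (hU.mem_nhds hz) : ∀ᶠ w in 𝓝[≠] z, w ∈ U))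
    filter_upwards [ht2, (hright z hz).filter_mono nhdsWithin_le_nhds] with y hy hy2
    have := hgood (g y) hy.2 hy.1
    rwa [hy2] at this

/-- Holomorphic dependence of the solution `u` of `u = a w + E (w, u)` on the parameter `w`. -/
theorem exists_holomorphic_fixedPoint {U : Set ℂ} (hU : IsOpen U) {E : ℂ × ℂ → ℂ} {a : ℂ → ℂ} {ρ : ℝ}
    (hρ : 0 < ρ) (hE : DifferentiableOn ℂ E (U ×ˢ Metric.ball 0 (2 * ρ)))
    (hEb : ∀ w ∈ U, ∀ s : ℂ, ‖s‖ < 2 * ρ → ‖E (w, s)‖ ≤ ρ / 4)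
    (ha : DifferentiableOn ℂ a U) (hab : ∀ w ∈ U, ‖a w‖ ≤ ρ / 2) :
    ∃ u : ℂ → ℂ, DifferentiableOn ℂ u U ∧ (∀ w ∈ U, ‖u w‖ ≤ ρ ∧ u w = a w + E (w, u w)) ∧
      ∀ w ∈ U, ∀ s : ℂ, ‖s‖ ≤ ρ → s = a w + E (w, s) → s = u w := by
  have hsl : ∀ w ∈ U, DifferentiableOn ℂ (fun s => E (w, s)) (Metric.ball 0 (2 * ρ)) := by
    intro w hw
    refine hE.comp (by fun_prop) fun s hs => ⟨hw, hs⟩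
  have hder : ∀ w ∈ U, ∀ s : ℂ, ‖s‖ ≤ ρ → ‖deriv (fun s => E (w, s)) s‖ ≤ 1 / 2 := by
    intro w hw s hs
    have hin : ∀ y ∈ Metric.closedBall s (ρ / 2), y ∈ Metric.ball (0 : ℂ) (2 * ρ) := by
      intro y hy
      rw [mem_ball_zero_iff]
      have h1 : ‖y - s‖ ≤ ρ / 2 := by simpa [dist_eq_norm] using hy
      have h2 := norm_add_le (y - s) s
      rw [sub_add_cancel] at h2
      linarith
    -- Cauchy's estimate on a circle of radius $\rho/2$, where $|E|\le\rho/4$, gives the contraction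
    -- constant $1/2$.
    have := Complex.norm_deriv_le_of_forall_mem_sphere_norm_le (f := fun s => E (w, s)) (c := s)
      (R := ρ / 2) (C := ρ / 4) (by positivity) ?_ ?_
    · refine this.trans (le_of_eq ?_)
      field_simp; norm_num
    · refine DifferentiableOn.diffContOnCl ?_
      rw [closure_ball _ (by positivity)]
      exact (hsl w hw).mono hin
    · intro z hz
      exact hEb w hw z (by simpa using hin z (Metric.sphere_subset_closedBall hz))
  have hlip : ∀ w ∈ U, ∀ s s' : ℂ, ‖s‖ ≤ ρ → ‖s'‖ ≤ ρ → ‖E (w, s) - E (w, s')‖ ≤ 1 / 2 * ‖s - s'‖ := by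
    intro w hw s s' hs hs'
    refine (convex_closedBall (0 : ℂ) ρ).norm_image_sub_le_of_norm_deriv_le
      (f := fun s => E (w, s)) (𝕜 := ℂ) (C := 1 / 2) ?_ ?_ (by simpa using hs') (by simpa using hs)
    · intro x hx
      refine (hsl w hw).differentiableAt (Metric.isOpen_ball.mem_nhds ?_)
      simp at hx ⊢; linarith
    · intro x hx
      exact hder w hw x (by simpa using hx)
  -- Picard iteration from $0$. The iterates stay in the disc of radius $\rho$ since
  -- $\rho/2+\rho/4\le\rho$, and converge uniformly, so the limit is holomorphic.
  let v : ℕ → ℂ → ℂ := fun n => Nat.rec (fun _ => 0) (fun _ f w => a w + E (w, f w)) n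
  have hv0 : ∀ w, v 0 w = 0 := fun _ => rfl
  have hvs : ∀ n w, v (n + 1) w = a w + E (w, v n w) := fun _ _ => rfl
  have hvb : ∀ n, ∀ w ∈ U, ‖v n w‖ ≤ ρ := by
    intro n
    induction n with
    | zero => intro w _; rw [hv0]; simpa using hρ.le
    | succ n ih =>
      intro w hw
      rw [hvs]
      have h1 := hEb w hw (v n w) (by linarith [ih w hw])
      linarith [norm_add_le (a w) (E (w, v n w)), hab w hw]
  have hvd : ∀ n, DifferentiableOn ℂ (v n) U := by
    intro n
    induction n with
    | zero => exact differentiableOn_const 0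
    | succ n ih =>
      refine ha.add (hE.comp (differentiableOn_id.prodMk ih) fun w hw => ⟨hw, ?_⟩)
      simpa using lt_of_le_of_lt (hvb n w hw) (by linarith)
  have hdist : ∀ w ∈ U, ∀ n, dist (v n w) (v (n + 1) w) ≤ ρ * (1 / 2) ^ n := by
    intro w hw n
    induction n with
    | zero =>
      rw [hv0, dist_zero_left]; simpa using hvb 1 w hw
    | succ n ih =>
      rw [hvs n, hvs (n + 1), dist_add_left, dist_eq_norm]
      refine (hlip w hw (v n w) (v (n + 1) w) (hvb n w hw) (hvb (n + 1) w hw)).trans ?_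
      rw [← dist_eq_norm, pow_succ]
      linarith
  have hlim : ∀ w ∈ U, ∃ l, Tendsto (fun n => v n w) atTop (𝓝 l) := fun w hw =>
    cauchySeq_tendsto_of_complete (cauchySeq_of_le_geometric (1 / 2) ρ (by norm_num) (hdist w hw))
  choose! u hu using hlim
  have hub : ∀ w ∈ U, ‖u w‖ ≤ ρ := fun w hw =>
    le_of_tendsto (hu w hw).norm (Eventually.of_forall fun n => hvb n w hw)
  have hfix : ∀ w ∈ U, u w = a w + E (w, u w) := by
    intro w hw
    have h1 : Tendsto (fun n => v (n + 1) w) atTop (𝓝 (u w)) := (tendsto_add_atTop_iff_nat 1).2 (hu w hw)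
    have hc : ContinuousAt (fun s => E (w, s)) (u w) := by
      refine ((hsl w hw).differentiableAt (Metric.isOpen_ball.mem_nhds ?_)).continuousAt
      simpa using lt_of_le_of_lt (hub w hw) (by linarith)
    have h2 : Tendsto (fun n => a w + E (w, v n w)) atTop (𝓝 (a w + E (w, u w))) :=
      tendsto_const_nhds.add (hc.tendsto.comp (hu w hw))
    exact tendsto_nhds_unique h1 h2
  refine ⟨u, ?_, fun w hw => ⟨hub w hw, hfix w hw⟩, ?_⟩
  · have hunif : TendstoUniformlyOn v u atTop U := by
      rw [Metric.tendstoUniformlyOn_iff]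
      intro ε hε
      have ht : Tendsto (fun n : ℕ => ρ * (1 / 2 : ℝ) ^ n / (1 - 1 / 2)) atTop (𝓝 0) := by
        have := ((tendsto_pow_atTop_nhds_zero_of_lt_one (r := (1 / 2 : ℝ)) (by norm_num)
          (by norm_num)).const_mul ρ).div_const (1 - 1 / 2)
        simpa using this
      filter_upwards [ht.eventually (gt_mem_nhds hε)] with n hn w hw
      rw [dist_comm]
      exact (dist_le_of_le_geometric_of_tendsto (1 / 2) ρ (by norm_num) (hdist w hw) (hu w hw) n).trans_lt hn
    exact hunif.tendstoLocallyUniformlyOn.differentiableOn (Eventually.of_forall hvd) hU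
  · intro w hw s hs hseq
    have h1 := hlip w hw s (u w) hs (hub w hw)
    have h2 : s - u w = E (w, s) - E (w, u w) := by
      calc s - u w = (a w + E (w, s)) - (a w + E (w, u w)) := by rw [← hseq, ← hfix w hw]
        _ = _ := by ring
    rw [← h2] at h1
    have h3 : ‖s - u w‖ = 0 := le_antisymm (by linarith) (norm_nonneg _)
    exact sub_eq_zero.1 (norm_eq_zero.1 h3)

/-! ### Fourier decay of periodic holomorphic functions -/

theorem exists_bound_of_periodic {f : ℂ → ℂ} {σ σ' : ℝ} (hσ : σ < σ')
    (hf : ContinuousOn f (horizontalStrip σ'))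
    (hper : ∀ z ∈ horizontalStrip σ', f (z + 1) = f z) :
    ∃ M, 0 < M ∧ ∀ z ∈ horizontalStrip σ, ‖f z‖ ≤ M := by
  have hK : IsCompact (Set.Icc (0 : ℝ) 1 ×ℂ Set.Icc (-σ) σ) := isCompact_Icc.reProdIm isCompact_Icc
  have hsub : Set.Icc (0 : ℝ) 1 ×ℂ Set.Icc (-σ) σ ⊆ horizontalStrip σ' := by
    intro z hz
    rw [Complex.mem_reProdIm] at hz
    exact lt_of_le_of_lt (abs_le.2 hz.2) hσ
  obtain ⟨M, hM⟩ := hK.exists_bound_of_continuousOn (hf.mono hsub)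
  have hint : ∀ z ∈ horizontalStrip σ', ∀ n : ℤ, f (z + n) = f z := by
    intro z hz n
    induction n with
    | zero => simp
    | succ n ih =>
      rw [← ih]; push_cast; rw [← add_assoc]
      exact hper _ (by simpa [horizontalStrip] using hz)
    | pred n ih =>
      rw [← ih]
      have := hper (z + (-n - 1 : ℤ)) (by simpa [horizontalStrip] using hz)
      rw [← this]; push_cast; congr 1; ring
  refine ⟨max M 1, by positivity, fun z hz => ?_⟩
  have h1 := hint z (horizontalStrip_mono hσ.le hz) (-⌊z.re⌋)
  rw [← h1]
  refine (hM _ ?_).trans (le_max_left _ _)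
  rw [Complex.mem_reProdIm]
  have hz' := abs_lt.1 (mem_horizontalStrip.1 hz)
  refine ⟨⟨?_, ?_⟩, ?_, ?_⟩
  · simpa using Int.floor_le z.re
  · simp; linarith [Int.lt_floor_add_one z.re]
  · simpa using hz'.1.le
  · simpa using hz'.2.le

/-- Cauchy's theorem on a rectangle of width one period: the vertical sides cancel. This shift of
contour makes Fourier coefficients decay. -/
theorem intervalIntegral_eq_of_periodic {f : ℂ → ℂ} {σ : ℝ}
    (hf : DifferentiableOn ℂ f (horizontalStrip σ))
    (hper : ∀ z ∈ horizontalStrip σ, f (z + 1) = f z) {y : ℝ} (hy : |y| < σ) :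
    ∫ x in (0 : ℝ)..1, f (x + y * Complex.I) = ∫ x in (0 : ℝ)..1, f x := by
  have hside : ∀ t : ℝ, t ∈ Set.uIcc 0 y → |t| < σ := by
    intro t ht
    have h1 := Set.abs_sub_left_of_mem_uIcc ht
    simp only [sub_zero] at h1
    exact h1.trans_lt hy
  have h := Complex.integral_boundary_rect_eq_zero_of_differentiableOn f 0 (1 + y * Complex.I)
    (hf.mono ?_)
  · have h2 : ∫ t in (0 : ℝ)..y, f (1 + t * Complex.I) = ∫ t in (0 : ℝ)..y, f (t * Complex.I) := by
      refine intervalIntegral.integral_congr fun t ht => ?_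
      have := hper (t * Complex.I) (by simpa [horizontalStrip] using hside t ht)
      simpa [add_comm] using this
    simp at h
    rw [h2] at h
    linear_combination -h
  · intro z hz
    rw [Complex.mem_reProdIm] at hz
    exact hside z.im (by simpa using hz.2)

theorem hasSum_fourier_of_periodic {f : ℝ → ℂ} (hf : Continuous f) (hper : Function.Periodic f 1)
    (hs : Summable fun m : ℤ => ∫ x in (0 : ℝ)..1, Complex.exp (-(2 * Real.pi * Complex.I * m * x)) * f x)
    (x : ℝ) :
    HasSum (fun m : ℤ => (∫ x in (0 : ℝ)..1, Complex.exp (-(2 * Real.pi * Complex.I * m * x)) * f x)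
      * Complex.exp (2 * Real.pi * Complex.I * m * x)) (f x) := by
  let F : C(AddCircle (1 : ℝ), ℂ) := ⟨hper.lift, continuous_coinduced_dom.2 hf⟩
  have hF : ∀ x : ℝ, F x = f x := fun x => rfl
  have hco : ∀ m : ℤ, fourierCoeff F m =
      ∫ x in (0 : ℝ)..1, Complex.exp (-(2 * Real.pi * Complex.I * m * x)) * f x := by
    intro m
    rw [fourierCoeff_eq_intervalIntegral F m 0]
    simp only [one_div, inv_one, one_smul, zero_add]
    refine intervalIntegral.integral_congr fun x _ => ?_
    simp only [smul_eq_mul, hF]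
    rw [fourier_coe_apply]
    congr 2
    push_cast; ring
  have h := has_pointwise_sum_fourier_series_of_summable (f := F) (by simpa only [funext hco] using hs) x
  rw [hF] at h
  convert h using 2 with m
  rw [hco, fourier_coe_apply, smul_eq_mul]
  congr 2
  push_cast; ring

theorem summable_and_tsum_bound {c : ℤ → ℂ} {M r : ℝ} (hr : 0 ≤ r) (hr1 : r < 1)
    (hc : ∀ m, ‖c m‖ ≤ M * r ^ m.natAbs) :
    Summable c ∧ ‖(∑' m, c m) - c 0‖ ≤ 2 * M * r / (1 - r) := by
  have hg : HasSum (fun n : ℕ => M * r ^ (n + 1)) (M * r / (1 - r)) := by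
    have := (hasSum_geometric_of_lt_one hr hr1).mul_left (M * r)
    simpa [pow_succ, mul_assoc, mul_comm, mul_left_comm, div_eq_mul_inv] using this
  have h1 : ∀ n : ℕ, ‖c (n + 1)‖ ≤ M * r ^ (n + 1) := fun n => by
    have := hc (n + 1); rwa [show ((n : ℤ) + 1).natAbs = n + 1 by omega] at this
  have h2 : ∀ n : ℕ, ‖c (-(n + 1))‖ ≤ M * r ^ (n + 1) := fun n => by
    have := hc (-(n + 1)); rwa [show (-((n : ℤ) + 1)).natAbs = n + 1 by omega] at this
  have s1 : Summable fun n : ℕ => c (n + 1) := Summable.of_norm_bounded hg.summable h1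
  have s2 : Summable fun n : ℕ => c (-(n + 1)) := Summable.of_norm_bounded hg.summable h2
  have s1' : Summable fun n : ℕ => c n := by
    rw [← summable_nat_add_iff 1]; exact_mod_cast s1
  have hs := HasSum.of_nat_of_neg_add_one s1'.hasSum s2.hasSum
  refine ⟨hs.summable, ?_⟩
  rw [hs.tsum_eq, s1'.tsum_eq_zero_add]
  have e1 : ‖∑' n : ℕ, c ((n + 1 : ℕ) : ℤ)‖ ≤ M * r / (1 - r) :=
    tsum_of_norm_bounded hg (by exact_mod_cast h1)
  have e2 : ‖∑' n : ℕ, c (-(n + 1))‖ ≤ M * r / (1 - r) := tsum_of_norm_bounded hg h2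
  calc _ = ‖(∑' n : ℕ, c ((n + 1 : ℕ) : ℤ)) + ∑' n : ℕ, c (-(n + 1))‖ := by
        congr 1; simp; ring
    _ ≤ _ := (norm_add_le _ _).trans (by
      have : 2 * M * r / (1 - r) = M * r / (1 - r) + M * r / (1 - r) := by ring
      linarith)

/-- A `1`-periodic holomorphic function on a strip, bounded by `M`, is close to a constant well
inside the strip. -/
theorem exists_norm_sub_le_of_periodic {f : ℂ → ℂ} {σ M : ℝ}
    (hf : DifferentiableOn ℂ f (horizontalStrip σ))
    (hper : ∀ z ∈ horizontalStrip σ, f (z + 1) = f z)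
    (hM : ∀ z ∈ horizontalStrip σ, ‖f z‖ ≤ M) :
    ∃ c₀ : ℂ, ∀ z ∈ horizontalStrip σ, ‖f z - c₀‖ ≤
      2 * M * Real.exp (-(2 * Real.pi * (σ - |z.im|))) /
        (1 - Real.exp (-(2 * Real.pi * (σ - |z.im|)))) := by
  let e : ℤ → ℂ → ℂ := fun m z => Complex.exp (-(2 * Real.pi * Complex.I * m * z)) * f z
  have hed : ∀ m, DifferentiableOn ℂ (e m) (horizontalStrip σ) := fun m =>
    DifferentiableOn.mul (by fun_prop) hf
  have hep : ∀ m, ∀ z ∈ horizontalStrip σ, e m (z + 1) = e m z := by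
    intro m z hz
    simp only [e]
    rw [hper z hz]
    congr 1
    rw [Complex.exp_eq_exp_iff_exists_int]
    exact ⟨-m, by push_cast; ring⟩
  let c : ℤ → ℂ := fun m => ∫ x in (0 : ℝ)..1, e m x
  have hcy : ∀ m (y : ℝ), |y| < σ → ∫ x in (0 : ℝ)..1, e m (x + y * Complex.I) = c m := fun m y hy =>
    intervalIntegral_eq_of_periodic (hed m) (hep m) hy
  have hnexp : ∀ (m : ℤ) (z : ℂ), ‖Complex.exp (-(2 * Real.pi * Complex.I * m * z))‖ =
      Real.exp (2 * Real.pi * m * z.im) := by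
    intro m z
    rw [Complex.norm_exp]
    congr 1
    simp
  have hcb : ∀ m : ℤ, ∀ y : ℝ, |y| < σ → ‖c m‖ ≤ Real.exp (2 * Real.pi * m * y) * M := by
    intro m y hy
    rw [← hcy m y hy]
    have := intervalIntegral.norm_integral_le_of_norm_le_const (a := (0 : ℝ)) (b := 1)
      (f := fun x : ℝ => e m (x + y * Complex.I)) (C := Real.exp (2 * Real.pi * m * y) * M) ?_
    · simpa using this
    · intro x _
      simp only [e]
      rw [norm_mul, hnexp]
      have h1 : ((x : ℂ) + y * Complex.I).im = y := by simp
      rw [h1]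
      gcongr
      exact hM _ (by simpa [horizontalStrip] using hy)
  have hcb' : ∀ m : ℤ, 0 < σ → ‖c m‖ ≤ M * Real.exp (-(2 * Real.pi * σ)) ^ m.natAbs := by
    intro m hσ
    -- The contour can only be moved inside the open strip, to height $-s$ or $s$ according to the
    -- sign of $m$; the bound at $\sigma$ follows by letting $s\to\sigma$.
    have key : ∀ s : ℝ, 0 < s → s < σ → ‖c m‖ ≤ M * Real.exp (-(2 * Real.pi * s)) ^ m.natAbs := by
      intro s hs hsσ
      rw [← Real.exp_nat_mul]
      rcases le_total 0 m with h | h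
      · have := hcb m (-s) (by rwa [abs_neg, abs_of_pos hs])
        rw [mul_comm] at this
        convert this using 3
        have : (m.natAbs : ℝ) = m := by
          rw [Nat.cast_natAbs, abs_of_nonneg h]
        rw [this]; ring
      · have := hcb m s (by rwa [abs_of_pos hs])
        rw [mul_comm] at this
        convert this using 3
        have : (m.natAbs : ℝ) = -m := by
          rw [Nat.cast_natAbs, abs_of_nonpos h, Int.cast_neg]
        rw [this]; ring
    have ht : Tendsto (fun s : ℝ => M * Real.exp (-(2 * Real.pi * s)) ^ m.natAbs) (𝓝[<] σ)
        (𝓝 (M * Real.exp (-(2 * Real.pi * σ)) ^ m.natAbs)) := by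
      refine Tendsto.mono_left (Continuous.tendsto (by fun_prop) σ) nhdsWithin_le_nhds
    refine ge_of_tendsto ht ?_
    filter_upwards [Ioo_mem_nhdsLT hσ] with s hs using key s hs.1 hs.2
  refine ⟨c 0, fun z hz => ?_⟩
  have hz' := mem_horizontalStrip.1 hz
  have hσ : 0 < σ := (abs_nonneg _).trans_lt hz'
  set y := z.im with hy
  let d : ℤ → ℂ := fun m => c m * Complex.exp (2 * Real.pi * Complex.I * m * z)
  have hdb : ∀ m : ℤ, ‖d m‖ ≤ M * Real.exp (-(2 * Real.pi * (σ - |y|))) ^ m.natAbs := by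
    intro m
    simp only [d]
    rw [norm_mul]
    have h1 : ‖Complex.exp (2 * Real.pi * Complex.I * m * z)‖ ≤
        Real.exp (2 * Real.pi * |y|) ^ m.natAbs := by
      have h2 := hnexp (-m) z
      have h3 : -(2 * Real.pi * Complex.I * ((-m : ℤ) : ℂ) * z) = 2 * Real.pi * Complex.I * m * z := by
        push_cast; ring
      rw [h3] at h2
      rw [h2, ← Real.exp_nat_mul, Real.exp_le_exp]
      have h4 : ((-m : ℤ) : ℝ) * z.im ≤ |(m : ℝ)| * |y| := by
        refine (le_abs_self _).trans ?_
        rw [abs_mul]; simp [hy]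
      have h5 : (m.natAbs : ℝ) = |(m : ℝ)| := by rw [Nat.cast_natAbs, Int.cast_abs]
      rw [h5]
      nlinarith [Real.pi_pos, h4]
    calc ‖c m‖ * ‖Complex.exp (2 * Real.pi * Complex.I * m * z)‖
        ≤ (M * Real.exp (-(2 * Real.pi * σ)) ^ m.natAbs) * Real.exp (2 * Real.pi * |y|) ^ m.natAbs :=
          mul_le_mul (hcb' m hσ) h1 (norm_nonneg _) ((norm_nonneg _).trans (hcb' m hσ))
      _ = _ := by
          rw [mul_assoc, ← mul_pow, ← Real.exp_add]; congr 3; ring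
  have hr1 : Real.exp (-(2 * Real.pi * (σ - |y|))) < 1 := by
    rw [Real.exp_lt_one_iff]
    have : 0 < Real.pi * (σ - |y|) := mul_pos Real.pi_pos (by linarith)
    linarith
  obtain ⟨hsum, hbound⟩ := summable_and_tsum_bound (Real.exp_pos _).le hr1 hdb
  have hcoef : ∀ m : ℤ, ∫ x in (0 : ℝ)..1, Complex.exp (-(2 * Real.pi * Complex.I * m * x)) *
      f (x + y * Complex.I) = c m * Complex.exp (2 * Real.pi * Complex.I * m * (y * Complex.I)) := by
    intro m
    rw [← hcy m y hz', ← intervalIntegral.integral_mul_const]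
    refine intervalIntegral.integral_congr fun x _ => ?_
    simp only [e]
    rw [mul_right_comm (Complex.exp _) (f _) (Complex.exp _), ← Complex.exp_add]
    congr 2; ring
  have hcoefs : Summable fun m : ℤ => ∫ x in (0 : ℝ)..1,
      Complex.exp (-(2 * Real.pi * Complex.I * m * x)) * f (x + y * Complex.I) := by
    refine Summable.of_norm_bounded (g := fun m => ‖d m‖) hsum.norm fun m => ?_
    rw [hcoef]
    simp only [d]
    rw [norm_mul, norm_mul]
    refine le_of_eq ?_
    congr 1
    rw [Complex.norm_exp, Complex.norm_exp]
    congr 1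
    simp [hy]
  have hcont : Continuous fun x : ℝ => f (x + y * Complex.I) := by
    refine hf.continuousOn.comp_continuous (by fun_prop) fun x => ?_
    simpa [horizontalStrip] using hz'
  have hp : Function.Periodic (fun x : ℝ => f (x + y * Complex.I)) 1 := by
    intro x
    have := hper (x + y * Complex.I) (by simpa [horizontalStrip] using hz')
    simp only
    rw [← this]; congr 1; push_cast; ring
  have hS := hasSum_fourier_of_periodic hcont hp hcoefs z.re
  have hz2 : (z.re : ℂ) + y * Complex.I = z := Complex.re_add_im z
  have hS2 : HasSum d (f z) := by
    rw [← hz2]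
    convert hS using 2 with m
    rw [hcoef, mul_assoc, ← Complex.exp_add]
    simp only [d]
    congr 2
    conv_lhs => rw [← hz2]
    ring
  rw [hS2.tsum_eq] at hbound
  simpa [d] using hbound

/-- Rescaling by $q$ makes the period $1$ and the half-width $q\sigma$. The condition $1\le 2\pi
q(\sigma-|\mathrm{Im}\,z|)$ keeps the geometric denominator at least $1/2$, which turns $2M$ into
$4M$. -/
theorem exists_norm_sub_le_of_periodic_one_div {f : ℂ → ℂ} {σ M : ℝ} {q : ℕ} (hq : 0 < q)
    (hf : DifferentiableOn ℂ f (horizontalStrip σ))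
    (hper : ∀ z ∈ horizontalStrip σ, f (z + 1 / q) = f z)
    (hM : ∀ z ∈ horizontalStrip σ, ‖f z‖ ≤ M) :
    ∃ c₀ : ℂ, ∀ z ∈ horizontalStrip σ, 1 ≤ 2 * Real.pi * (q * (σ - |z.im|)) → ‖f z - c₀‖ ≤
      4 * M * Real.exp (-(2 * Real.pi * (q * (σ - |z.im|)))) := by
  have hq' : (0 : ℝ) < q := by exact_mod_cast hq
  have hqc : (q : ℂ) ≠ 0 := by exact_mod_cast hq.ne'
  have him : ∀ z : ℂ, (z / q).im = z.im / q := by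
    intro z
    rw [← Complex.ofReal_natCast, Complex.div_ofReal_im]
  have hmem : ∀ z, z ∈ horizontalStrip (q * σ) → z / q ∈ horizontalStrip σ := by
    intro z hz
    rw [mem_horizontalStrip] at *
    rw [him, abs_div, abs_of_pos hq', div_lt_iff₀ hq']
    linarith
  obtain ⟨c₀, hc₀⟩ := exists_norm_sub_le_of_periodic (f := fun z => f (z / q)) (σ := q * σ) (M := M)
    (hf.comp (by fun_prop) hmem)
    (fun z hz => by rw [add_div]; exact hper _ (hmem z hz)) (fun z hz => hM _ (hmem z hz))
  refine ⟨c₀, fun z hz h1 => ?_⟩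
  have hM0 : 0 ≤ M := (norm_nonneg _).trans (hM z hz)
  have him2 : |((q : ℂ) * z).im| = q * |z.im| := by
    simp [abs_mul]
  have hz2 : (q : ℂ) * z ∈ horizontalStrip (q * σ) := by
    rw [mem_horizontalStrip, him2]
    exact mul_lt_mul_of_pos_left hz hq'
  have h := hc₀ _ hz2
  simp only [mul_div_cancel_left₀ z hqc] at h
  rw [him2, ← mul_sub] at h
  refine h.trans ?_
  set x := 2 * Real.pi * (q * (σ - |z.im|))
  have hx : Real.exp (-x) ≤ 1 / 2 := by
    calc Real.exp (-x) ≤ Real.exp (-1) := Real.exp_le_exp.2 (by linarith)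
      _ ≤ 1 / 2 := by
        rw [Real.exp_neg, inv_eq_one_div]
        apply one_div_le_one_div_of_le (by norm_num)
        linarith [Real.add_one_le_exp (1 : ℝ)]
  have hx0 := Real.exp_pos (-x)
  rw [div_le_iff₀ (by linarith)]
  have : 0 ≤ M * Real.exp (-x) := by positivity
  nlinarith

/-- Bézout: if $ap+bq=1$ then $1/q=a(p/q)+b$ is an integer combination of the two periods. -/
theorem periodic_one_div_of_coprime {f : ℂ → ℂ} {σ : ℝ} {p : ℤ} {q : ℕ} (hq : 0 < q)
    (hpq : IsCoprime p (q : ℤ))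
    (h1 : ∀ z ∈ horizontalStrip σ, f (z + 1) = f z)
    (h2 : ∀ z ∈ horizontalStrip σ, f (z + p / q) = f z) :
    ∀ z ∈ horizontalStrip σ, f (z + 1 / q) = f z := by
  have aux : ∀ s : ℝ, (∀ z ∈ horizontalStrip σ, f (z + s) = f z) →
      ∀ n : ℤ, ∀ z ∈ horizontalStrip σ, f (z + n * s) = f z := by
    intro s hs n z hz
    have hm : ∀ t : ℝ, z + t ∈ horizontalStrip σ := add_ofReal_mem_horizontalStrip hz
    induction n with
    | zero => simp
    | succ n ih =>
      refine Eq.trans ?_ ((hs (z + (n : ℤ) * s) (by simpa using hm (n * s))).trans ih)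
      push_cast; ring_nf
    | pred n ih =>
      have := hs _ (by simpa using hm ((-n - 1) * s))
      rw [← ih]
      push_cast
      rw [← this]
      ring_nf
  obtain ⟨a, b, hab⟩ := hpq
  intro z hz
  have e1 := aux (p / q) (by simpa using h2) a z hz
  have e2 := aux 1 (by simpa using h1) b _ (by simpa using add_ofReal_mem_horizontalStrip hz (a * (p / q)))
  rw [← e1]
  simp only [Complex.ofReal_div, Complex.ofReal_intCast, Complex.ofReal_natCast, Complex.ofReal_one] at e1 e2 ⊢
  rw [← e2]
  have hqc : (q : ℂ) ≠ 0 := by exact_mod_cast hq.ne'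
  congr 1
  have : (a : ℂ) * p + b * q = 1 := by exact_mod_cast hab
  field_simp
  linear_combination -this

/-! ### Orbits of perturbed rotations -/

/-- `w ↦ w + θ + g (w, t)` is a holomorphic family of `1`-periodic perturbations of the rotation by
`θ` on a strip of half-width `σ`, with infinitesimal displacement `h` at `t = 0`. -/
structure IsRotationPerturbation (θ σ r B c : ℝ) (g : ℂ × ℂ → ℂ) (h : ℂ → ℂ) : Prop where
  width_pos : 0 < σ
  radius_pos : 0 < r
  radius_le_one : r ≤ 1
  bound_pos : 0 < B
  lower_pos : 0 < c
  differentiableOn : DifferentiableOn ℂ g (horizontalStrip σ ×ˢ Metric.ball 0 r)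
  map_add_one : ∀ w ∈ horizontalStrip σ, ∀ t, ‖t‖ < r → g (w + 1, t) = g (w, t)
  norm_sub_le : ∀ w ∈ horizontalStrip σ, ∀ t, ‖t‖ < r → ‖g (w, t) - t * h w‖ ≤ B * ‖t‖ ^ 2
  differentiableOn_deriv : DifferentiableOn ℂ h (horizontalStrip σ)
  deriv_add_one : ∀ w ∈ horizontalStrip σ, h (w + 1) = h w
  norm_deriv_le : ∀ w ∈ horizontalStrip σ, ‖h w‖ ≤ B
  lipschitz_deriv : ∀ w ∈ horizontalStrip σ, ∀ w' ∈ horizontalStrip σ,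
    ‖h w - h w'‖ ≤ B * ‖w - w'‖
  le_re_deriv : ∀ x : ℝ, c ≤ (h x).re

/-- The orbit of `w` under `w ↦ w + θ + g (w, t)`. -/
def perturbedOrbit (θ : ℝ) (g : ℂ × ℂ → ℂ) (t w : ℂ) (k : ℕ) : ℂ :=
  (fun w => w + θ + g (w, t))^[k] w

theorem perturbedOrbit_zero (θ : ℝ) (g : ℂ × ℂ → ℂ) (t w : ℂ) : perturbedOrbit θ g t w 0 = w := rfl

theorem perturbedOrbit_succ (θ : ℝ) (g : ℂ × ℂ → ℂ) (t w : ℂ) (k : ℕ) :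
    perturbedOrbit θ g t w (k + 1) =
      perturbedOrbit θ g t w k + θ + g (perturbedOrbit θ g t w k, t) := by
  simp only [perturbedOrbit, Function.iterate_succ_apply']

theorem perturbedOrbit_succ' (θ : ℝ) (g : ℂ × ℂ → ℂ) (t w : ℂ) (k : ℕ) :
    perturbedOrbit θ g t w (k + 1) = perturbedOrbit θ g t (w + θ + g (w, t)) k := by
  simp only [perturbedOrbit, Function.iterate_succ_apply]

theorem perturbedOrbit_eq_sum (θ : ℝ) (g : ℂ × ℂ → ℂ) (t w : ℂ) (k : ℕ) :
    perturbedOrbit θ g t w k =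
      w + k * θ + ∑ j ∈ Finset.range k, g (perturbedOrbit θ g t w j, t) := by
  induction k with
  | zero => simp [perturbedOrbit_zero]
  | succ k ih =>
    rw [perturbedOrbit_succ, Finset.sum_range_succ, ← add_assoc]
    nth_rw 1 [ih]
    push_cast; ring

namespace IsRotationPerturbation

variable {θ σ r B c : ℝ} {g : ℂ × ℂ → ℂ} {h : ℂ → ℂ}

theorem norm_le (H : IsRotationPerturbation θ σ r B c g h) {w t : ℂ} (hw : w ∈ horizontalStrip σ)
    (ht : ‖t‖ < r) : ‖g (w, t)‖ ≤ 2 * B * ‖t‖ := by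
  have h1 := H.norm_sub_le w hw t ht
  have h2 : ‖t * h w‖ ≤ ‖t‖ * B := by
    rw [norm_mul]; gcongr; exact H.norm_deriv_le w hw
  have h3 := norm_add_le (g (w, t) - t * h w) (t * h w)
  rw [sub_add_cancel] at h3
  have h4 : B * ‖t‖ ^ 2 ≤ B * ‖t‖ := by
    have := H.bound_pos
    have := H.radius_le_one
    gcongr
    exact pow_le_of_le_one (norm_nonneg _) (by linarith) two_ne_zero
  linarith

/-- The two conclusions feed each other: while the orbit stays in the strip each step deviates from
the rotation by at most $2B|t|$, and the accumulated deviation keeps it in the strip. -/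
theorem norm_perturbedOrbit_sub_le (H : IsRotationPerturbation θ σ r B c g h) {s : ℝ} {w t : ℂ}
    (hw : w ∈ horizontalStrip s) (ht : ‖t‖ < r) (k : ℕ) (hs : s + k * (2 * B * ‖t‖) ≤ σ) :
    ‖perturbedOrbit θ g t w k - (w + k * θ)‖ ≤ k * (2 * B * ‖t‖) ∧
      perturbedOrbit θ g t w k ∈ horizontalStrip σ := by
  have hmem : ∀ k : ℕ, s + k * (2 * B * ‖t‖) ≤ σ →
      ‖perturbedOrbit θ g t w k - (w + k * θ)‖ ≤ k * (2 * B * ‖t‖) →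
      perturbedOrbit θ g t w k ∈ horizontalStrip σ := by
    intro k hk h1
    have h2 := add_mem_horizontalStrip (z := w + k * θ) (σ := s)
      (by simpa using add_ofReal_mem_horizontalStrip hw (k * θ)) h1
    rw [add_sub_cancel] at h2
    exact horizontalStrip_mono hk h2
  have hB := H.bound_pos
  suffices h0 : ‖perturbedOrbit θ g t w k - (w + k * θ)‖ ≤ k * (2 * B * ‖t‖) from ⟨h0, hmem k hs h0⟩
  induction k with
  | zero => simp [perturbedOrbit_zero]
  | succ k ih =>
    have hs' : s + k * (2 * B * ‖t‖) ≤ σ := by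
      refine le_trans ?_ hs
      push_cast
      have : 0 ≤ 2 * B * ‖t‖ := by positivity
      linarith
    have h1 := ih hs'
    have h2 := H.norm_le (hmem k hs' h1) ht
    rw [perturbedOrbit_succ]
    have h3 := norm_add_le (perturbedOrbit θ g t w k - (w + k * θ)) (g (perturbedOrbit θ g t w k, t))
    calc _ = ‖perturbedOrbit θ g t w k - (w + k * θ) + g (perturbedOrbit θ g t w k, t)‖ := by
          congr 1; push_cast; ring
      _ ≤ _ := by push_cast; linarith

theorem map_add_int (H : IsRotationPerturbation θ σ r B c g h) {w t : ℂ}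
    (hw : w ∈ horizontalStrip σ) (ht : ‖t‖ < r) (n : ℤ) : g (w + n, t) = g (w, t) := by
  have hm : ∀ x : ℝ, w + x ∈ horizontalStrip σ := add_ofReal_mem_horizontalStrip hw
  induction n with
  | zero => simp
  | succ n ih =>
    rw [← ih, ← H.map_add_one (w + (n : ℤ)) (by simpa using hm n) t ht]
    push_cast; ring_nf
  | pred n ih =>
    rw [← ih, ← H.map_add_one (w + (-n - 1 : ℤ)) (by simpa using hm (-n - 1)) t ht]
    push_cast; ring_nf

theorem differentiableOn_perturbedOrbit (H : IsRotationPerturbation θ σ r B c g h) {s R : ℝ}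
    (hR : R ≤ r) (k : ℕ) (hs : s + k * (2 * B * R) ≤ σ) :
    DifferentiableOn ℂ (fun z : ℂ × ℂ => perturbedOrbit θ g z.2 z.1 k)
      (horizontalStrip s ×ˢ Metric.ball 0 R) := by
  rcases (Metric.ball (0 : ℂ) R).eq_empty_or_nonempty with h0 | h0
  · rw [h0, Set.prod_empty]; exact differentiableOn_empty
  have hR0 : 0 < R := Metric.nonempty_ball.1 h0
  have hB := H.bound_pos
  induction k with
  | zero => simp only [perturbedOrbit_zero]; fun_prop
  | succ k ih =>
    have hs' : s + k * (2 * B * R) ≤ σ := by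
      refine le_trans ?_ hs
      push_cast
      have : 0 ≤ 2 * B * R := by positivity
      linarith
    have h1 := ih hs'
    simp only [perturbedOrbit_succ]
    refine (h1.add_const _).add ?_
    refine H.differentiableOn.comp (h1.prodMk differentiableOn_snd) ?_
    rintro ⟨w, t⟩ ⟨hw, ht⟩
    simp only [mem_ball_zero_iff] at ht
    refine ⟨(H.norm_perturbedOrbit_sub_le hw (ht.trans_le hR) k ?_).2, ?_⟩
    · refine le_trans ?_ hs'
      gcongr
    · simpa using ht.trans_le hR

/-! ### The closing parameter -/

/-- The Birkhoff averages of `h` along the rotation by `p / q` are nearly constant. -/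
theorem exists_norm_average_sub_le (H : IsRotationPerturbation θ σ r B c g h) {p : ℤ} {q : ℕ}
    (hq : 0 < q) (hpq : IsCoprime p (q : ℤ)) {δ : ℝ} (hδσ : δ < σ)
    (hqδ : 1 ≤ 2 * Real.pi * (q * δ))
    (hc : 4 * B * Real.exp (-(2 * Real.pi * (q * δ))) ≤ c / 2) :
    ∃ A : ℂ, c / 2 ≤ ‖A‖ ∧ ∀ w ∈ horizontalStrip (σ - δ),
      ‖(∑ k ∈ Finset.range q, h (w + k * (p / q))) - q * A‖ ≤
        q * (4 * B * Real.exp (-(2 * Real.pi * (q * δ)))) := by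
  have hq' : (0 : ℝ) < q := by exact_mod_cast hq
  have hqc : (q : ℂ) ≠ 0 := by exact_mod_cast hq.ne'
  have hm : ∀ w ∈ horizontalStrip σ, ∀ x : ℝ, w + x ∈ horizontalStrip σ :=
    fun w hw => add_ofReal_mem_horizontalStrip hw
  have hm' : ∀ w ∈ horizontalStrip σ, ∀ k : ℕ, w + k * (p / q) ∈ horizontalStrip σ := by
    intro w hw k
    simpa using hm w hw (k * (p / q))
  have hint : ∀ w ∈ horizontalStrip σ, ∀ n : ℤ, h (w + n) = h w := by
    intro w hw n
    induction n with
    | zero => simp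
    | succ n ih =>
      rw [← ih, ← H.deriv_add_one (w + (n : ℤ)) (by simpa using hm w hw n)]
      push_cast; ring_nf
    | pred n ih =>
      rw [← ih, ← H.deriv_add_one (w + (-n - 1 : ℤ)) (by simpa using hm w hw (-n - 1))]
      push_cast; ring_nf
  let f : ℂ → ℂ := fun w => (1 / q) * ∑ k ∈ Finset.range q, h (w + k * (p / q))
  have hfd : DifferentiableOn ℂ f (horizontalStrip σ) := by
    refine DifferentiableOn.const_mul (DifferentiableOn.fun_sum fun k _ => ?_) _
    exact H.differentiableOn_deriv.comp (by fun_prop) fun w hw => hm' w hw k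
  have hfb : ∀ w ∈ horizontalStrip σ, ‖f w‖ ≤ B := by
    intro w hw
    have : ‖∑ k ∈ Finset.range q, h (w + k * (p / q))‖ ≤ q * B := by
      refine (norm_sum_le_of_le _ fun k _ => H.norm_deriv_le _ (hm' w hw k)).trans ?_
      simp
    simp only [f]
    rw [norm_mul, norm_div, norm_one, Complex.norm_natCast, one_div_mul_eq_div, div_le_iff₀ hq']
    linarith
  have hf1 : ∀ w ∈ horizontalStrip σ, f (w + 1) = f w := by
    intro w hw
    simp only [f]
    congr 1
    refine Finset.sum_congr rfl fun k _ => ?_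
    rw [← H.deriv_add_one _ (hm' w hw k)]
    congr 1; ring
  -- Shifting by $p/q$ raises every index by one; the new last term $h(w+p)$ equals the lost first
  -- term $h(w)$.
  have hf2 : ∀ w ∈ horizontalStrip σ, f (w + p / q) = f w := by
    intro w hw
    simp only [f]
    congr 1
    have e1 : ∀ k ∈ Finset.range q, h (w + p / q + k * (p / q)) = h (w + (k + 1 : ℕ) * (p / q)) := by
      intro k _
      congr 1; push_cast; ring
    rw [Finset.sum_congr rfl e1]
    have e2 := Finset.sum_range_succ (fun k : ℕ => h (w + k * (p / q))) q
    have e3 := Finset.sum_range_succ' (fun k : ℕ => h (w + k * (p / q))) q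
    have e4 : h (w + q * (p / q)) = h w := by
      rw [mul_div_cancel₀ _ hqc]; exact hint w hw p
    rw [e3, e4] at e2
    simpa using e2
  obtain ⟨A, hA⟩ := exists_norm_sub_le_of_periodic_one_div hq hfd
    (periodic_one_div_of_coprime hq hpq hf1 hf2) hfb
  have hB := H.bound_pos
  have hA' : ∀ w ∈ horizontalStrip (σ - δ),
      ‖f w - A‖ ≤ 4 * B * Real.exp (-(2 * Real.pi * (q * δ))) := by
    intro w hw
    have hw1 := mem_horizontalStrip.1 hw
    have hδ0 : 0 < δ := by
      by_contra hneg
      have : 2 * Real.pi * (q * δ) ≤ 0 := by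
        have : (q : ℝ) * δ ≤ 0 := mul_nonpos_of_nonneg_of_nonpos hq'.le (by linarith)
        nlinarith [Real.pi_pos]
      linarith
    have hmono : 2 * Real.pi * (q * δ) ≤ 2 * Real.pi * (q * (σ - |w.im|)) := by
      have := Real.pi_pos
      gcongr
      linarith
    refine (hA w (horizontalStrip_mono (by linarith) hw) (hqδ.trans hmono)).trans ?_
    gcongr
  refine ⟨A, ?_, ?_⟩
  -- At $w=0$ all points of the rotation orbit are real, so the average has real part at least $c$;
  -- the error takes away at most $c/2$.
  · have h0 := hA' 0 (by simpa using ofReal_mem_horizontalStrip (σ := σ - δ) (by linarith) 0)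
    have h1 : c ≤ (f 0).re := by
      simp only [f]
      have e : ∀ k : ℕ, ((0 : ℂ) + k * (p / q)) = ((k * (p / q) : ℝ) : ℂ) := by
        intro k; push_cast; ring
      have e2 : ((1 : ℂ) / q) = ((1 / q : ℝ) : ℂ) := by push_cast; ring
      rw [e2, Complex.re_ofReal_mul, Complex.re_sum, one_div_mul_eq_div, le_div_iff₀ hq']
      calc c * q = ∑ k ∈ Finset.range q, c := by simp [mul_comm]
        _ ≤ _ := Finset.sum_le_sum fun k _ => by rw [e]; exact H.le_re_deriv _
    have h2 := Complex.re_le_norm (f 0)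
    have h3 := norm_sub_norm_le (f 0) A
    linarith
  · intro w hw
    have := hA' w hw
    have e : (∑ k ∈ Finset.range q, h (w + k * (p / q))) - q * A = q * (f w - A) := by
      simp only [f]
      rw [mul_sub, ← mul_assoc, mul_one_div_cancel hqc, one_mul]
    rw [e, norm_mul, Complex.norm_natCast]
    gcongr

/-- The parameter `T w` for which the orbit of `w` closes up after `q` steps depends
holomorphically on `w`. -/
theorem exists_closing_parameter (H : IsRotationPerturbation θ σ r B c g h) {p : ℤ} {q : ℕ}
    (hq : 0 < q) (hpq : IsCoprime p (q : ℤ)) {δ η ρ : ℝ} (hδσ : δ < σ)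
    (hqδ : 1 ≤ 2 * Real.pi * (q * δ)) (hρ : 0 < ρ) (hρr : 2 * ρ ≤ r)
    (hρη : q * (2 * B * (2 * ρ)) ≤ η) (hηδ : η ≤ δ) (hθη : q * |θ - p / q| ≤ η)
    (hθρ : |θ - p / q| ≤ c / 4 * ρ)
    (hsmall : 2 * B * ρ + 2 * B * η + 4 * B * Real.exp (-(2 * Real.pi * (q * δ))) ≤ c / 16) :
    ∃ T : ℂ → ℂ, DifferentiableOn ℂ T (horizontalStrip (σ - δ)) ∧
      (∀ w ∈ horizontalStrip (σ - δ), ‖T w‖ ≤ ρ ∧ perturbedOrbit θ g (T w) w q = w + p) ∧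
      ∀ w ∈ horizontalStrip (σ - δ), ∀ t : ℂ, ‖t‖ ≤ ρ → perturbedOrbit θ g t w q = w + p →
        t = T w := by
  have hB := H.bound_pos
  have hcpos := H.lower_pos
  have hq' : (0 : ℝ) < q := by exact_mod_cast hq
  have hqc : (q : ℂ) ≠ 0 := by exact_mod_cast hq.ne'
  have hη0 : 0 ≤ η := le_trans (by positivity) hθη
  set ε := 4 * B * Real.exp (-(2 * Real.pi * (q * δ))) with hε
  have hε0 : 0 ≤ ε := by positivity
  obtain ⟨A, hAc, hA⟩ := H.exists_norm_average_sub_le hq hpq hδσ hqδ (by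
    have : 0 ≤ 2 * B * ρ := by positivity
    have : 0 ≤ 2 * B * η := by positivity
    linarith)
  have hA0 : A ≠ 0 := by
    intro h0
    rw [h0, norm_zero] at hAc
    linarith
  have hk : ∀ k : ℕ, k ≤ q → σ - δ + k * (2 * B * (2 * ρ)) ≤ σ := by
    intro k hk
    have : (k : ℝ) * (2 * B * (2 * ρ)) ≤ q * (2 * B * (2 * ρ)) := by gcongr
    linarith
  have horb : ∀ w ∈ horizontalStrip (σ - δ), ∀ t : ℂ, ‖t‖ < 2 * ρ → ∀ k : ℕ, k ≤ q →
      ‖perturbedOrbit θ g t w k - (w + k * θ)‖ ≤ η ∧ perturbedOrbit θ g t w k ∈ horizontalStrip σ := by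
    intro w hw t ht k hkq
    have h1 : (k : ℝ) * (2 * B * ‖t‖) ≤ k * (2 * B * (2 * ρ)) := by gcongr
    have h2 : (k : ℝ) * (2 * B * (2 * ρ)) ≤ q * (2 * B * (2 * ρ)) := by gcongr
    have h3 := H.norm_perturbedOrbit_sub_le hw (ht.trans_le hρr) k (by linarith [hk k hkq])
    exact ⟨by linarith [h3.1], h3.2⟩
  let S : ℂ × ℂ → ℂ := fun z => ∑ k ∈ Finset.range q, g (perturbedOrbit θ g z.2 z.1 k, z.2)
  have hSd : DifferentiableOn ℂ S (horizontalStrip (σ - δ) ×ˢ Metric.ball 0 (2 * ρ)) := by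
    refine DifferentiableOn.fun_sum fun k hkq => ?_
    have hkq' : k ≤ q := (Finset.mem_range.1 hkq).le
    refine H.differentiableOn.comp ((H.differentiableOn_perturbedOrbit hρr k (hk k hkq')).prodMk
      differentiableOn_snd) ?_
    rintro ⟨w, t⟩ ⟨hw, ht⟩
    simp only [mem_ball_zero_iff] at ht
    exact ⟨(horb w hw t ht k hkq').2, by simpa using ht.trans_le hρr⟩
  -- The three errors are the quadratic remainder of $g$, the drift of the orbit from the
  -- $p/q$-rotation, and the nonconstancy of the averages. After division by $q|A|\ge qc/2$, the
  -- constant $c/16$ gives the bound $\rho/4$ of the fixed point lemma.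
  have hSb : ∀ w ∈ horizontalStrip (σ - δ), ∀ t : ℂ, ‖t‖ < 2 * ρ →
      ‖S (w, t) - q * A * t‖ ≤ q * (2 * ρ * (c / 16)) := by
    intro w hw t ht
    have hterm : ∀ k ∈ Finset.range q, ‖g (perturbedOrbit θ g t w k, t) - t * h (w + k * (p / q))‖ ≤
        ‖t‖ * (2 * B * ρ + 2 * B * η) := by
      intro k hkq
      have hkq' : k ≤ q := (Finset.mem_range.1 hkq).le
      obtain ⟨h1, h2⟩ := horb w hw t ht k hkq'
      have h3 := H.norm_sub_le _ h2 t (ht.trans_le hρr)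
      have hm : w + k * (p / q) ∈ horizontalStrip σ := by
        have := add_ofReal_mem_horizontalStrip (horizontalStrip_mono (σ' := σ) (by linarith) hw)
          (k * (p / q))
        simpa using this
      have h4 := H.lipschitz_deriv _ h2 _ hm
      have h5 : ‖perturbedOrbit θ g t w k - (w + k * (p / q))‖ ≤ 2 * η := by
        have e : perturbedOrbit θ g t w k - (w + k * (p / q)) =
            (perturbedOrbit θ g t w k - (w + k * θ)) + ((k * (θ - p / q) : ℝ) : ℂ) := by
          push_cast; ring
        rw [e]
        refine (norm_add_le _ _).trans ?_
        have : ‖((k * (θ - p / q) : ℝ) : ℂ)‖ ≤ η := by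
          rw [Complex.norm_real, Real.norm_eq_abs, abs_mul, Nat.abs_cast]
          refine le_trans ?_ hθη
          gcongr
        linarith
      have e : g (perturbedOrbit θ g t w k, t) - t * h (w + k * (p / q)) =
          (g (perturbedOrbit θ g t w k, t) - t * h (perturbedOrbit θ g t w k)) +
          t * (h (perturbedOrbit θ g t w k) - h (w + k * (p / q))) := by ring
      rw [e]
      refine (norm_add_le _ _).trans ?_
      rw [norm_mul]
      have h6 : ‖t‖ * ‖h (perturbedOrbit θ g t w k) - h (w + k * (p / q))‖ ≤ ‖t‖ * (B * (2 * η)) := by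
        gcongr
        exact h4.trans (by gcongr)
      have h7 : B * ‖t‖ ^ 2 ≤ ‖t‖ * (2 * B * ρ) := by
        have : ‖t‖ * ‖t‖ ≤ ‖t‖ * (2 * ρ) := by gcongr
        nlinarith
      linarith
    have e : S (w, t) - q * A * t =
        (∑ k ∈ Finset.range q, (g (perturbedOrbit θ g t w k, t) - t * h (w + k * (p / q)))) +
        t * ((∑ k ∈ Finset.range q, h (w + k * (p / q))) - q * A) := by
      simp only [S]
      rw [Finset.sum_sub_distrib, ← Finset.mul_sum]
      ring
    rw [e]
    refine (norm_add_le _ _).trans ?_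
    have h1 : ‖∑ k ∈ Finset.range q, (g (perturbedOrbit θ g t w k, t) - t * h (w + k * (p / q)))‖ ≤
        q * (‖t‖ * (2 * B * ρ + 2 * B * η)) :=
      (norm_sum_le_of_le _ hterm).trans (by simp)
    have h2 : ‖t * ((∑ k ∈ Finset.range q, h (w + k * (p / q))) - q * A)‖ ≤ ‖t‖ * (q * ε) := by
      rw [norm_mul]; gcongr; exact hA w hw
    calc _ ≤ q * (‖t‖ * (2 * B * ρ + 2 * B * η)) + ‖t‖ * (q * ε) := add_le_add h1 h2
      _ = q * (‖t‖ * (2 * B * ρ + 2 * B * η + ε)) := by ring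
      _ ≤ q * (2 * ρ * (c / 16)) := by gcongr
  have hqA : (q : ℂ) * A ≠ 0 := mul_ne_zero hqc hA0
  -- Newton-like form of the closing equation: $S(w,t)=p-q\theta$ is divided by the approximate
  -- slope $qA$, leaving a small nonlinear term.
  have hequiv : ∀ w t : ℂ, (t = -(q * θ - p) / (q * A) + (t - S (w, t) / (q * A))) ↔
      perturbedOrbit θ g t w q = w + p := by
    intro w t
    rw [perturbedOrbit_eq_sum]
    change _ ↔ w + q * θ + S (w, t) = w + p
    constructor
    · intro h0
      have : S (w, t) / (q * A) = -(q * θ - p) / (q * A) := by linear_combination h0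
      rw [div_left_inj' hqA] at this
      rw [this]; ring
    · intro h0
      have : S (w, t) = -(q * θ - p) := by linear_combination h0
      rw [this]; ring
  have hEb : ∀ w ∈ horizontalStrip (σ - δ), ∀ t : ℂ, ‖t‖ < 2 * ρ →
      ‖t - S (w, t) / (q * A)‖ ≤ ρ / 4 := by
    intro w hw t ht
    have e : t - S (w, t) / (q * A) = -(S (w, t) - q * A * t) / (q * A) := by
      field_simp; ring
    rw [e, norm_div, norm_neg, norm_mul, Complex.norm_natCast, div_le_iff₀ (by positivity)]
    refine (hSb w hw t ht).trans ?_
    have : ρ / 4 * (q * (c / 2)) ≤ ρ / 4 * (q * ‖A‖) := by gcongr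
    refine le_trans (le_of_eq ?_) this
    ring
  have hab : ‖(-(q * θ - p) / (q * A) : ℂ)‖ ≤ ρ / 2 := by
    have e : (-(q * θ - p) / (q * A) : ℂ) = -((θ - p / q : ℝ) : ℂ) / A := by
      push_cast; field_simp
    rw [e, norm_div, norm_neg, Complex.norm_real, Real.norm_eq_abs, div_le_iff₀ (by positivity)]
    refine hθρ.trans ?_
    have : ρ / 2 * (c / 2) ≤ ρ / 2 * ‖A‖ := by gcongr
    linarith
  obtain ⟨T, hT1, hT2, hT3⟩ := exists_holomorphic_fixedPoint (isOpen_horizontalStrip (σ - δ))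
    (E := fun z => z.2 - S z / (q * A)) (a := fun _ => -(q * θ - p) / (q * A)) hρ
    (by
      simp only [div_eq_mul_inv]
      exact differentiableOn_snd.sub (hSd.mul_const _)) hEb (differentiableOn_const _) fun _ _ => hab
  refine ⟨T, hT1, fun w hw => ⟨(hT2 w hw).1, (hequiv _ _).1 (hT2 w hw).2⟩, fun w hw t ht hp => ?_⟩
  exact hT3 w hw t ht ((hequiv _ _).2 hp)

end IsRotationPerturbation

/-! ### Hidden periodicity of the closing parameter -/

namespace IsRotationPerturbation

variable {θ σ r B c : ℝ} {g : ℂ × ℂ → ℂ} {h : ℂ → ℂ}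

theorem perturbedOrbit_add_int (H : IsRotationPerturbation θ σ r B c g h) {w t : ℂ} (ht : ‖t‖ < r)
    (n : ℤ) {m : ℕ} (hmem : ∀ k < m, perturbedOrbit θ g t w k ∈ horizontalStrip σ) :
    ∀ k ≤ m, perturbedOrbit θ g t (w + n) k = perturbedOrbit θ g t w k + n := by
  intro k hk
  induction k with
  | zero => simp [perturbedOrbit_zero]
  | succ k ih =>
    rw [perturbedOrbit_succ, perturbedOrbit_succ, ih (by omega), H.map_add_int (hmem k hk) ht n]
    ring

/-- If the parameters closing up the orbits after `q` steps are holomorphic in the base point, then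
those of real points are exponentially close to each other: in suitable coordinates the closing
parameter is `1 / q`-periodic. -/
theorem exists_norm_closing_parameter_sub_le (H : IsRotationPerturbation θ σ r B c g h) {p : ℤ} {q : ℕ}
    (hq : 0 < q) (hpq : IsCoprime p (q : ℤ)) {δ η ρ : ℝ} (hηpos : 0 < η)
    (hρ : 0 < ρ) (hρr : 2 * ρ ≤ r)
    (hρη : q * (2 * B * (2 * ρ)) ≤ η) (hηδ : η ≤ δ) (hθη : q * |θ - p / q| ≤ η)
    {T : ℂ → ℂ} (hTd : DifferentiableOn ℂ T (horizontalStrip (σ - δ)))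
    (hT : ∀ w ∈ horizontalStrip (σ - δ), ‖T w‖ ≤ ρ ∧ perturbedOrbit θ g (T w) w q = w + p)
    (hTu : ∀ w ∈ horizontalStrip (σ - δ), ∀ t : ℂ, ‖t‖ ≤ ρ → perturbedOrbit θ g t w q = w + p →
        t = T w)
    (hqη : 1 ≤ 2 * Real.pi * (q * (σ - δ - 18 * η))) :
    ∃ c₀ : ℂ, ∀ (x : ℝ) (t : ℂ), ‖t‖ ≤ ρ → perturbedOrbit θ g t x q = x + p →
      ‖t - c₀‖ ≤ 4 * ρ * Real.exp (-(2 * Real.pi * (q * (σ - δ - 18 * η)))) := by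
  have hB := H.bound_pos
  have hq' : (0 : ℝ) < q := by exact_mod_cast hq
  have hqc : (q : ℂ) ≠ 0 := by exact_mod_cast hq.ne'
  have hpos : 18 * η < σ - δ := by
    by_contra hneg
    have h1 : (q : ℝ) * (σ - δ - 18 * η) ≤ 0 :=
      mul_nonpos_of_nonneg_of_nonpos hq'.le (by linarith)
    nlinarith [Real.pi_pos]
  set s := σ - δ with hs
  have hk : ∀ k : ℕ, k ≤ q → (k : ℝ) * (2 * B * (2 * ρ)) ≤ η := by
    intro k hk
    have : (k : ℝ) * (2 * B * (2 * ρ)) ≤ q * (2 * B * (2 * ρ)) := by gcongr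
    linarith
  have horb : ∀ w ∈ horizontalStrip s, ∀ t : ℂ, ‖t‖ ≤ ρ → ∀ k : ℕ, k ≤ q →
      ‖perturbedOrbit θ g t w k - (w + k * θ)‖ ≤ η ∧ perturbedOrbit θ g t w k ∈ horizontalStrip σ := by
    intro w hw t ht k hkq
    have h1 : (k : ℝ) * (2 * B * ‖t‖) ≤ k * (2 * B * (2 * ρ)) := by gcongr; linarith
    have h3 := H.norm_perturbedOrbit_sub_le hw (by linarith : ‖t‖ < r) k (by linarith [hk k hkq])
    exact ⟨by linarith [h3.1, hk k hkq], h3.2⟩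
  let O : ℕ → ℂ → ℂ := fun k w => perturbedOrbit θ g (T w) w k
  have hOd : ∀ k ≤ q, DifferentiableOn ℂ (O k) (horizontalStrip s) := by
    intro k hkq
    refine (H.differentiableOn_perturbedOrbit (s := s) hρr k (by linarith [hk k hkq])).comp
      (differentiableOn_id.prodMk hTd) fun w hw => ⟨hw, ?_⟩
    simpa using lt_of_le_of_lt (hT w hw).1 (by linarith)
  have hO : ∀ w ∈ horizontalStrip s, ∀ k ≤ q, ‖O k w - (w + k * (p / q))‖ ≤ 2 * η := by
    intro w hw k hkq
    have h1 := (horb w hw _ (hT w hw).1 k hkq).1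
    have e : O k w - (w + k * (p / q)) =
        (perturbedOrbit θ g (T w) w k - (w + k * θ)) + ((k * (θ - p / q) : ℝ) : ℂ) := by
      simp only [O]; push_cast; ring
    rw [e]
    refine (norm_add_le _ _).trans ?_
    have : ‖((k * (θ - p / q) : ℝ) : ℂ)‖ ≤ η := by
      rw [Complex.norm_real, Real.norm_eq_abs, abs_mul, Nat.abs_cast]
      refine le_trans ?_ hθη
      gcongr
    linarith
  have hT1 : ∀ w ∈ horizontalStrip s, ∀ n : ℤ, T (w + n) = T w := by
    intro w hw n
    have hw' : w + n ∈ horizontalStrip s := by simpa using add_ofReal_mem_horizontalStrip hw n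
    refine (hTu _ hw' _ (hT w hw).1 ?_).symm
    rw [H.perturbedOrbit_add_int (by linarith [(hT w hw).1]) n (m := q)
      (fun k hk => (horb w hw _ (hT w hw).1 k hk.le).2) q le_rfl, (hT w hw).2]
    ring
  have hO1 : ∀ w ∈ horizontalStrip s, ∀ k ≤ q, O k (w + 1) = O k w + 1 := by
    intro w hw k hkq
    simp only [O]
    have e := hT1 w hw 1
    have e2 := H.perturbedOrbit_add_int (θ := θ) (by linarith [(hT w hw).1]) 1 (m := q)
      (fun k hk => (horb w hw _ (hT w hw).1 k hk.le).2) k hkq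
    simp only [Int.cast_one] at e e2
    rw [e, e2]
  let R : ℂ → ℂ := fun w => w + θ + g (w, T w)
  have hRO : ∀ w, R w = O 1 w := fun w => by
    simp only [R, O]; rw [perturbedOrbit_succ, perturbedOrbit_zero]
  -- The orbit closed by $T(w)$ is also closed when started at its second point; uniqueness of the
  -- closing parameter there gives the invariance.
  have hTR : ∀ w ∈ horizontalStrip s, R w ∈ horizontalStrip s → T (R w) = T w := by
    intro w hw hRw
    refine (hTu _ hRw _ (hT w hw).1 ?_).symm
    have hw' : w ∈ horizontalStrip σ := horizontalStrip_mono (by linarith) hw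
    rw [← perturbedOrbit_succ', perturbedOrbit_succ, (hT w hw).2,
      H.map_add_int hw' (by linarith [(hT w hw).1])]
    simp only [R]; ring
  have hOR : ∀ w ∈ horizontalStrip s, R w ∈ horizontalStrip s → ∀ k, O k (R w) = O (k + 1) w := by
    intro w hw hRw k
    simp only [O]
    rw [hTR w hw hRw, perturbedOrbit_succ']
  -- Average of the orbit after undoing the rotation by $p/q$. As the orbit closes up after $q$
  -- steps, replacing $w$ by $R(w)$ only reindexes the sum and adds $p/q$.
  let Λ : ℂ → ℂ := fun w => (1 / q) * ∑ k ∈ Finset.range q, (O k w - k * (p / q))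
  have hΛd : DifferentiableOn ℂ Λ (horizontalStrip s) := by
    refine DifferentiableOn.const_mul (DifferentiableOn.fun_sum fun k hk => ?_) _
    exact (hOd k (Finset.mem_range.1 hk).le).sub_const _
  have hΛ : ∀ w ∈ horizontalStrip s, ‖Λ w - w‖ ≤ 2 * η := by
    intro w hw
    have e : Λ w - w = (1 / q) * ∑ k ∈ Finset.range q, (O k w - (w + k * (p / q))) := by
      have : ∑ k ∈ Finset.range q, (O k w - (w + k * (p / q))) =
          (∑ k ∈ Finset.range q, (O k w - k * (p / q))) - q * w := by
        simp only [Finset.sum_sub_distrib, Finset.sum_add_distrib, Finset.sum_const,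
          Finset.card_range, nsmul_eq_mul]
        ring
      rw [this]
      simp only [Λ]
      rw [mul_sub, ← mul_assoc _ (q : ℂ), one_div_mul_cancel hqc, one_mul]
    have h1 : ‖∑ k ∈ Finset.range q, (O k w - (w + k * (p / q)))‖ ≤ q * (2 * η) :=
      (norm_sum_le_of_le _ fun k hk => hO w hw k (Finset.mem_range.1 hk).le).trans (by simp)
    rw [e, norm_mul, norm_div, norm_one, Complex.norm_natCast, one_div_mul_eq_div, div_le_iff₀ hq']
    linarith
  have hΛ1 : ∀ w ∈ horizontalStrip s, Λ (w + 1) = Λ w + 1 := by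
    intro w hw
    have : ∑ k ∈ Finset.range q, (O k (w + 1) - k * (p / q)) =
        (∑ k ∈ Finset.range q, (O k w - k * (p / q))) + q := by
      rw [Finset.sum_congr rfl fun k hk => by
        rw [hO1 w hw k (Finset.mem_range.1 hk).le, add_sub_right_comm]]
      simp [Finset.sum_add_distrib]
    simp only [Λ]
    rw [this, mul_add, one_div_mul_cancel hqc]
  have hΛR : ∀ w ∈ horizontalStrip s, R w ∈ horizontalStrip s → Λ (R w) = Λ w + p / q := by
    intro w hw hRw
    have e1 := Finset.sum_range_succ (fun k => O k w) q
    rw [Finset.sum_range_succ'] at e1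
    have e2 : O q w = w + p := (hT w hw).2
    have e3 : O 0 w = w := rfl
    rw [e2, e3] at e1
    have : ∑ k ∈ Finset.range q, (O k (R w) - k * (p / q)) =
        (∑ k ∈ Finset.range q, (O k w - k * (p / q))) + p := by
      rw [Finset.sum_congr rfl fun k _ => by rw [hOR w hw hRw k]]
      simp only [Finset.sum_sub_distrib]
      linear_combination e1
    simp only [Λ]
    rw [this, mul_add, one_div_mul_eq_div (q : ℂ) (p : ℂ)]
  -- Inverts $\Lambda$ as $z\mapsto z+u(z)$. Since $|\Lambda-\mathrm{id}|\le 2\eta$, the fixed point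
  -- lemma needs radius $8\eta$, and its disc of radius $16\eta$ is the loss of width.
  obtain ⟨u, hud, hu, huu⟩ := exists_holomorphic_fixedPoint (isOpen_horizontalStrip (s - 16 * η))
    (E := fun z => (z.1 + z.2) - Λ (z.1 + z.2)) (a := fun _ => 0) (ρ := 8 * η) (by linarith)
    (by
      have hm : Set.MapsTo (fun z : ℂ × ℂ => z.1 + z.2)
          (horizontalStrip (s - 16 * η) ×ˢ Metric.ball 0 (2 * (8 * η))) (horizontalStrip s) := by
        rintro ⟨z, v⟩ ⟨hz, hv⟩
        simp only [mem_ball_zero_iff] at hv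
        exact horizontalStrip_mono (by linarith) (add_mem_horizontalStrip hz hv.le)
      exact (differentiableOn_fst.add differentiableOn_snd).sub
        (hΛd.comp (differentiableOn_fst.add differentiableOn_snd) hm))
    (by
      intro z hz v hv
      have := hΛ (z + v) (horizontalStrip_mono (by linarith) (add_mem_horizontalStrip hz hv.le))
      rw [norm_sub_rev]; simp only; linarith)
    (differentiableOn_const _) (by intro z _; simp; linarith)
  set s' := s - 16 * η with hs'
  have hin : ∀ z ∈ horizontalStrip s', z + u z ∈ horizontalStrip (s' + 8 * η) := fun z hz =>
    add_mem_horizontalStrip hz (hu z hz).1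
  have hin' : ∀ z ∈ horizontalStrip s', z + u z ∈ horizontalStrip s := fun z hz =>
    horizontalStrip_mono (by linarith) (hin z hz)
  have hinv : ∀ z ∈ horizontalStrip s', Λ (z + u z) = z := by
    intro z hz
    have := (hu z hz).2
    linear_combination this
  have huniq : ∀ z ∈ horizontalStrip s', ∀ w ∈ horizontalStrip s, Λ w = z → w = z + u z := by
    intro z hz w hw hwz
    have h1 := huu z hz (w - z) (by
      have := hΛ w hw
      rw [hwz, norm_sub_rev] at this; linarith) (by
      rw [add_sub_cancel, hwz]; ring)
    rw [← h1]; ring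
  let f : ℂ → ℂ := fun z => T (z + u z)
  have hfd : DifferentiableOn ℂ f (horizontalStrip s') :=
    hTd.comp (differentiableOn_id.add hud) hin'
  have hf1 : ∀ z ∈ horizontalStrip s', f (z + 1) = f z := by
    intro z hz
    have hz1 : z + 1 ∈ horizontalStrip s' := by simpa using add_ofReal_mem_horizontalStrip hz 1
    have hw1 : z + u z + 1 ∈ horizontalStrip s := by
      simpa using add_ofReal_mem_horizontalStrip (hin' z hz) 1
    have := huniq (z + 1) hz1 (z + u z + 1) hw1 (by rw [hΛ1 _ (hin' z hz), hinv z hz])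
    simp only [f]
    rw [← this]
    simpa using hT1 _ (hin' z hz) 1
  have hf2 : ∀ z ∈ horizontalStrip s', f (z + p / q) = f z := by
    intro z hz
    have hz1 : z + p / q ∈ horizontalStrip s' := by
      simpa using add_ofReal_mem_horizontalStrip hz (p / q)
    have hw := hin' z hz
    have hRw : R (z + u z) ∈ horizontalStrip s := by
      have h1 := (horb _ hw _ (hT _ hw).1 1 hq).1
      have h2 := add_mem_horizontalStrip (add_ofReal_mem_horizontalStrip (hin z hz) θ) h1
      rw [hRO]
      refine horizontalStrip_mono (σ := s' + 8 * η + η) (by linarith) ?_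
      convert h2 using 1
      simp only [O]; push_cast; ring
    have := huniq (z + p / q) hz1 _ hRw (by rw [hΛR _ hw hRw, hinv z hz])
    simp only [f]
    rw [← this, hTR _ hw hRw]
  obtain ⟨c₀, hc₀⟩ := exists_norm_sub_le_of_periodic_one_div hq hfd
    (periodic_one_div_of_coprime hq hpq hf1 hf2) (fun z hz => (hT _ (hin' z hz)).1)
  refine ⟨c₀, fun x t ht hxt => ?_⟩
  have hx : (x : ℂ) ∈ horizontalStrip s := ofReal_mem_horizontalStrip (by linarith) x
  have htx := hTu x hx t ht hxt
  -- $\Lambda$ may move real points off the real line by $2\eta$; with the $16\eta$ lost in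
  -- inverting it, this makes $18\eta$.
  have him : |(Λ x).im| ≤ 2 * η := by
    have h1 := (Complex.abs_im_le_norm _).trans (hΛ x hx)
    simpa using h1
  have hz : Λ x ∈ horizontalStrip s' := lt_of_le_of_lt him (by linarith)
  have hxe := huniq _ hz x hx rfl
  have hft : f (Λ x) = t := by simp only [f]; rw [← hxe, htx]
  have hmono : 2 * Real.pi * (q * (s - 18 * η)) ≤ 2 * Real.pi * (q * (s' - |(Λ x).im|)) := by
    have h1 : s - 18 * η ≤ s' - |(Λ x).im| := by linarith
    have := Real.pi_pos
    exact mul_le_mul_of_nonneg_left (mul_le_mul_of_nonneg_left h1 hq'.le) (by positivity)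
  rw [← hft]
  refine (hc₀ _ hz (hqη.trans hmono)).trans ?_
  gcongr

/-- The scales are $\rho=K'/q^2$ for parameters and $\eta=D/q$ for deviations of orbits. Since
$q\cdot18\eta=18D$ is independent of $q$, the resulting loss is a constant factor, and only $\delta$
affects the exponential rate. -/
theorem exists_forall_closing_parameter (H : IsRotationPerturbation θ σ r B c g h) {δ : ℝ} (hδ : 0 < δ)
    (hδσ : δ < σ) (K : ℝ) :
    ∃ C : ℝ, 0 < C ∧ ∀ᶠ q : ℕ in atTop, ∀ p : ℤ, IsCoprime p (q : ℤ) → |θ - p / q| ≤ 1 / q ^ 2 →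
      ∃ c₀ : ℂ, ∀ (x : ℝ) (t : ℂ), ‖t‖ ≤ K / q ^ 2 → perturbedOrbit θ g t x q = x + p →
        ‖t - c₀‖ ≤ C * Real.exp (-(2 * Real.pi * (q * (σ - δ)))) := by
  have hB := H.bound_pos
  have hc := H.lower_pos
  have hr := H.radius_pos
  -- $4/c$ makes $1/q^2\le (c/4)\rho$, so that the disc of radius $\rho$ can absorb $\theta-p/q$.
  set K' := max K (4 / c) with hK'
  have hK'c : 4 / c ≤ K' := le_max_right _ _
  have hK'0 : 0 < K' := lt_of_lt_of_le (by positivity) hK'c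
  -- $4BK'$ bounds $q$ times the total deviation over $q$ steps, and $1$ bounds $q^2|\theta-p/q|$.
  set D := max (4 * B * K') 1 with hD
  have hD0 : 0 < D := lt_of_lt_of_le one_pos (le_max_right _ _)
  have hinv : Tendsto (fun q : ℕ => ((q : ℝ))⁻¹) atTop (𝓝 0) := tendsto_inv_atTop_nhds_zero_nat
  have hρt : Tendsto (fun q : ℕ => K' / (q : ℝ) ^ 2) atTop (𝓝 0) := by
    have := (hinv.pow 2).const_mul K'
    simpa [div_eq_mul_inv] using this
  have hηt : Tendsto (fun q : ℕ => D / (q : ℝ)) atTop (𝓝 0) := by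
    have := hinv.const_mul D
    simpa [div_eq_mul_inv] using this
  have hqt : Tendsto (fun q : ℕ => 2 * Real.pi * (q * δ)) atTop atTop :=
    (tendsto_natCast_atTop_atTop.atTop_mul_const hδ).const_mul_atTop (by positivity)
  have hqt2 : Tendsto (fun q : ℕ => 2 * Real.pi * (q * ((σ - δ) / 2))) atTop atTop :=
    (tendsto_natCast_atTop_atTop.atTop_mul_const (by linarith)).const_mul_atTop (by positivity)
  have hεt : Tendsto (fun q : ℕ => Real.exp (-(2 * Real.pi * (q * δ)))) atTop (𝓝 0) :=
    Real.tendsto_exp_neg_atTop_nhds_zero.comp hqt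
  have hst : Tendsto (fun q : ℕ => 2 * B * (K' / (q : ℝ) ^ 2) + 2 * B * (D / q) +
      4 * B * Real.exp (-(2 * Real.pi * (q * δ)))) atTop (𝓝 0) := by
    simpa using ((hρt.const_mul (2 * B)).add (hηt.const_mul (2 * B))).add (hεt.const_mul (4 * B))
  refine ⟨4 * Real.exp (2 * Real.pi * (18 * D)), by positivity, ?_⟩
  filter_upwards [eventually_gt_atTop 0, hρt.eventually (ge_mem_nhds (half_pos hr)),
    hηt.eventually (ge_mem_nhds hδ),
    hηt.eventually (ge_mem_nhds (show (0 : ℝ) < (σ - δ) / 36 by linarith)),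
    hqt.eventually_ge_atTop 1, hqt2.eventually_ge_atTop 1,
    hst.eventually (ge_mem_nhds (show 0 < c / 16 by positivity))]
    with q hq h1 h2 h3 h4 h5 h6 p hpq hpθ
  have hq' : (0 : ℝ) < q := by exact_mod_cast hq
  have hρ : 0 < K' / (q : ℝ) ^ 2 := by positivity
  have hη : 0 < D / (q : ℝ) := by positivity
  have hρη : q * (2 * B * (2 * (K' / (q : ℝ) ^ 2))) ≤ D / q := by
    have e : q * (2 * B * (2 * (K' / (q : ℝ) ^ 2))) = 4 * B * K' / q := by field_simp; ring
    rw [e]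
    gcongr
    exact le_max_left _ _
  have hθη : q * |θ - p / q| ≤ D / q := by
    calc q * |θ - p / q| ≤ q * (1 / (q : ℝ) ^ 2) := by gcongr
      _ = 1 / q := by field_simp
      _ ≤ D / q := by gcongr; exact le_max_right _ _
  have hθρ : |θ - p / q| ≤ c / 4 * (K' / (q : ℝ) ^ 2) := by
    refine hpθ.trans ?_
    rw [← mul_div_assoc]
    gcongr
    calc (1 : ℝ) = c / 4 * (4 / c) := by field_simp
      _ ≤ c / 4 * K' := by gcongr
  obtain ⟨T, hTd, hT, hTu⟩ := H.exists_closing_parameter hq hpq hδσ h4 hρ (by linarith) hρη h2 hθη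
    hθρ h6
  have hqη : 1 ≤ 2 * Real.pi * (q * (σ - δ - 18 * (D / q))) := by
    refine h5.trans ?_
    have := Real.pi_pos
    gcongr
    linarith
  obtain ⟨c₀, hc₀⟩ := H.exists_norm_closing_parameter_sub_le hq hpq hη hρ (by linarith) hρη h2 hθη
    hTd hT hTu hqη
  refine ⟨c₀, fun x t ht hxt => (hc₀ x t (ht.trans ?_) hxt).trans ?_⟩
  · gcongr; exact le_max_left _ _
  · have e : -(2 * Real.pi * (q * (σ - δ - 18 * (D / q)))) =
        2 * Real.pi * (18 * D) + -(2 * Real.pi * (q * (σ - δ))) := by field_simp; ring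
    rw [e, Real.exp_add, ← mul_assoc]
    have hle : K' / (q : ℝ) ^ 2 ≤ 1 := by linarith [H.radius_le_one]
    gcongr
    linarith

end IsRotationPerturbation

/-! ### Convergents of an irrational number -/

/-- Integrality lets the reduced denominator of a convergent be compared with the recursively
defined one: it divides it, hence is no larger, and the usual error bound transfers. -/
theorem GenContFract.exists_int_contsAux_eq (v : ℝ) (n : ℕ) :
    ∃ a b : ℤ, (GenContFract.of v).contsAux n = ⟨(a : ℝ), (b : ℝ)⟩ := by
  induction n using Nat.strong_induction_on with
  | _ n ih =>
    rcases n with _ | _ | n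
    · exact ⟨1, 0, by simp [GenContFract.contsAux]⟩
    · exact ⟨⌊v⌋, 1, by simp [GenContFract.contsAux]⟩
    · obtain ⟨a, b, h1⟩ := ih (n + 1) (by omega)
      rcases hs : (GenContFract.of v).s.get? n with _ | gp
      · refine ⟨a, b, ?_⟩
        rw [GenContFract.contsAux_stable_of_terminated (n + 1).le_succ hs, h1]
      · obtain ⟨a', b', h0⟩ := ih n (by omega)
        obtain ⟨ha, z, hb⟩ := GenContFract.of_partNum_eq_one_and_exists_int_partDen_eq hs
        refine ⟨z * a + a', z * b + b', ?_⟩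
        rw [GenContFract.contsAux_recurrence hs h0 h1, ha, hb]
        push_cast
        simp

theorem Irrational.abs_sub_convergent_le {θ : ℝ} (hθ : Irrational θ) (n : ℕ) :
    |θ - (θ.convergent n : ℚ)| ≤ 1 / ((θ.convergent n).den : ℝ) ^ 2 := by
  have hnt : ∀ n, ¬ (GenContFract.of θ).TerminatedAt n := by
    intro n hn
    obtain ⟨q, hq⟩ := (GenContFract.terminates_iff_rat θ).1 ⟨n, hn⟩
    exact hθ ⟨q, hq.symm⟩
  obtain ⟨a, b, hab⟩ := GenContFract.exists_int_contsAux_eq θ (n + 1)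
  have hnum : (GenContFract.of θ).nums n = a := by
    rw [GenContFract.num_eq_conts_a, GenContFract.nth_cont_eq_succ_nth_contAux, hab]
  have hden : (GenContFract.of θ).dens n = b := by
    rw [GenContFract.den_eq_conts_b, GenContFract.nth_cont_eq_succ_nth_contAux, hab]
  have hfib : (1 : ℝ) ≤ b := by
    have := GenContFract.succ_nth_fib_le_of_nth_den (v := θ) (n := n) (Or.inr (hnt _))
    rw [hden] at this
    refine le_trans ?_ this
    exact_mod_cast Nat.fib_pos.2 (Nat.succ_pos n)
  have hb1 : 1 ≤ b := by exact_mod_cast hfib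
  have hconv : θ.convergent n = (a : ℚ) / b := by
    have := Real.convs_eq_convergent θ n
    rw [GenContFract.conv_eq_num_div_den, hnum, hden] at this
    exact_mod_cast this.symm
  have hle : ((θ.convergent n).den : ℝ) ≤ b := by
    have h1 : ((θ.convergent n).den : ℤ) ∣ b := by
      rw [hconv, ← Rat.divInt_eq_div]; exact Rat.den_dvd a b
    exact_mod_cast Int.le_of_dvd (by omega) h1
  have hd0 : (0 : ℝ) < (θ.convergent n).den := by exact_mod_cast (θ.convergent n).den_pos
  have h := GenContFract.abs_sub_convs_le (hnt n)
  rw [Real.convs_eq_convergent] at h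
  refine h.trans ?_
  have hmono : (GenContFract.of θ).dens n ≤ (GenContFract.of θ).dens (n + 1) :=
    GenContFract.of_den_mono
  rw [hden] at hmono ⊢
  apply one_div_le_one_div_of_le (by positivity)
  rw [sq]
  exact mul_le_mul hle (hle.trans hmono) hd0.le (by linarith)

/-- Rationals of bounded denominator stay at a positive distance from $\theta$, while the
convergents approach it. -/
theorem Irrational.tendsto_convergent_den {θ : ℝ} (hθ : Irrational θ) :
    Tendsto (fun n => (θ.convergent n).den) atTop atTop := by
  rw [tendsto_atTop]
  intro N
  have h1 := hθ.eventually_forall_le_dist_cast_rat_of_den_le N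
  obtain ⟨ε, hε, hε0⟩ := ((h1.filter_mono nhdsWithin_le_nhds).and
    (self_mem_nhdsWithin : Set.Ioi (0 : ℝ) ∈ 𝓝[>] 0)).exists
  have h2 : Tendsto (fun n => ((θ.convergent n : ℚ) : ℝ)) atTop (𝓝 θ) := (GenContFract.of_convergence θ).congr fun n => Real.convs_eq_convergent θ n
  filter_upwards [Metric.tendsto_nhds.1 h2 ε hε0] with n hn
  by_contra hlt
  have := hε _ (not_le.1 hlt).le
  rw [dist_comm] at this
  linarith

/-! ### The linearizing map -/

namespace IsLinearizingMap

variable {F : CircleDeg1Lift} {Φ : ℝ → ℝ}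

/-- The averages at $F(x)$ and at $x$ differ by the telescoped term $(F^{\circ N}(x)-x)/N$, which
tends to the translation number. -/
theorem map_map (h : IsLinearizingMap F Φ) (x : ℝ) : Φ (F x) = Φ x + F.translationNumber := by
  refine tendsto_nhds_unique (h (F x)) (((h x).add (F.tendsto_translationNumber x)).congr' ?_)
  filter_upwards [eventually_gt_atTop 0] with N hN
  have hN' : (N : ℝ) ≠ 0 := by exact_mod_cast hN.ne'
  rw [CircleDeg1Lift.coe_pow]
  have e1 := Finset.sum_range_succ (fun k => F^[k] x) N
  rw [Finset.sum_range_succ'] at e1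
  simp only [← Function.iterate_succ_apply, Finset.sum_sub_distrib, ← Finset.sum_mul]
  simp only [Function.iterate_zero, id] at e1
  field_simp
  linear_combination -e1

theorem map_add_one (h : IsLinearizingMap F Φ) (x : ℝ) : Φ (x + 1) = Φ x + 1 := by
  refine tendsto_nhds_unique (h (x + 1)) (((h x).add_const 1).congr' ?_)
  filter_upwards [eventually_gt_atTop 0] with N hN
  have hN' : (N : ℝ) ≠ 0 := by exact_mod_cast hN.ne'
  have e : ∀ k : ℕ, F^[k] (x + 1) = F^[k] x + 1 := by
    intro k
    rw [← CircleDeg1Lift.coe_pow]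
    exact (F ^ k).map_add_one x
  simp only [e, Finset.sum_sub_distrib, Finset.sum_add_distrib, ← Finset.sum_mul]
  simp
  field_simp
  ring

theorem map_add_int (h : IsLinearizingMap F Φ) (x : ℝ) (n : ℤ) : Φ (x + n) = Φ x + n := by
  induction n with
  | zero => simp
  | succ n ih =>
    have := h.map_add_one (x + (n : ℤ))
    push_cast at this ih ⊢
    rw [← add_assoc, this, ih]; ring
  | pred n ih =>
    have := h.map_add_one (x + (-n - 1 : ℤ))
    have e : x + ((-n - 1 : ℤ) : ℝ) + 1 = x + ((-n : ℤ) : ℝ) := by push_cast; ring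
    rw [e, ih] at this
    push_cast at this ⊢
    linarith

theorem monotone (h : IsLinearizingMap F Φ) : Monotone Φ := by
  intro x y hxy
  refine le_of_tendsto_of_tendsto' (h x) (h y) fun N => ?_
  gcongr with k _
  exact F.monotone.iterate k hxy

end IsLinearizingMap

/-! ### From a Herman ring to a perturbed rotation -/

/-- Taylor's formula of order two for a bounded holomorphic function on a disc. -/
theorem norm_sub_sub_mul_deriv_le {f : ℂ → ℂ} {R M : ℝ} (hR : 0 < R)
    (hf : DifferentiableOn ℂ f (Metric.ball 0 R)) (hM : ∀ z, ‖z‖ < R → ‖f z‖ ≤ M) {t : ℂ}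
    (ht : ‖t‖ ≤ R / 4) :
    ‖deriv f 0‖ ≤ 4 * M / R ∧ ‖f t - f 0 - t * deriv f 0‖ ≤ 16 * M / R ^ 2 * ‖t‖ ^ 2 := by
  have hnorm : ∀ {z w : ℂ} {a b : ℝ}, ‖z‖ ≤ a → w ∈ Metric.closedBall z b → ‖w‖ ≤ a + b := by
    intro z w a b hz hw
    have h1 : ‖w - z‖ ≤ b := by simpa [dist_eq_norm] using hw
    have h2 := norm_add_le (w - z) z
    rw [sub_add_cancel] at h2
    linarith
  have hd1 : ∀ z, ‖z‖ ≤ R / 2 → ‖deriv f z‖ ≤ 4 * M / R := by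
    intro z hz
    have := Complex.norm_deriv_le_of_forall_mem_sphere_norm_le (f := f) (c := z) (R := R / 4)
      (C := M) (by positivity) ?_ ?_
    · refine this.trans (le_of_eq ?_); field_simp
    · refine DifferentiableOn.diffContOnCl (hf.mono fun w hw => ?_)
      rw [closure_ball _ (by positivity)] at hw
      have := hnorm hz hw
      rw [mem_ball_zero_iff]; linarith
    · intro w hw
      have := hnorm hz (Metric.sphere_subset_closedBall hw)
      exact hM w (by linarith)
  have hd' : DifferentiableOn ℂ (deriv f) (Metric.ball 0 R) := hf.deriv Metric.isOpen_ball
  have hd2 : ∀ z, ‖z‖ ≤ R / 4 → ‖deriv (deriv f) z‖ ≤ 16 * M / R ^ 2 := by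
    intro z hz
    have := Complex.norm_deriv_le_of_forall_mem_sphere_norm_le (f := deriv f) (c := z) (R := R / 4)
      (C := 4 * M / R) (by positivity) ?_ ?_
    · refine this.trans (le_of_eq ?_); field_simp; ring
    · refine DifferentiableOn.diffContOnCl (hd'.mono fun w hw => ?_)
      rw [closure_ball _ (by positivity)] at hw
      have := hnorm hz hw
      rw [mem_ball_zero_iff]; linarith
    · intro w hw
      have := hnorm hz (Metric.sphere_subset_closedBall hw)
      exact hd1 w (by linarith)
  refine ⟨hd1 0 (by simp; positivity), ?_⟩
  have hin : ∀ z ∈ Metric.closedBall (0 : ℂ) ‖t‖, ‖z‖ ≤ ‖t‖ := fun z hz => by simpa using hz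
  have hlip : ∀ z ∈ Metric.closedBall (0 : ℂ) ‖t‖, ‖deriv f z - deriv f 0‖ ≤ 16 * M / R ^ 2 * ‖t‖ := by
    intro z hz
    have := (convex_closedBall (0 : ℂ) ‖t‖).norm_image_sub_le_of_norm_deriv_le (f := deriv f) (𝕜 := ℂ)
      (C := 16 * M / R ^ 2) (x := 0) (y := z) ?_ ?_ (by simp) hz
    · rw [sub_zero] at this
      refine this.trans ?_
      have hM0 : 0 ≤ M := (norm_nonneg _).trans (hM 0 (by simpa using hR))
      gcongr
      exact hin z hz
    · intro w hw
      refine hd'.differentiableAt (Metric.isOpen_ball.mem_nhds ?_)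
      rw [mem_ball_zero_iff]; linarith [hin w hw]
    · intro w hw
      exact hd2 w (by linarith [hin w hw])
  have hder : ∀ z ∈ Metric.closedBall (0 : ℂ) ‖t‖,
      HasDerivWithinAt (fun z => f z - z * deriv f 0) (deriv f z - 1 * deriv f 0)
        (Metric.closedBall 0 ‖t‖) z := by
    intro z hz
    have : DifferentiableAt ℂ f z := by
      refine hf.differentiableAt (Metric.isOpen_ball.mem_nhds ?_)
      rw [mem_ball_zero_iff]; linarith [hin z hz]
    exact (this.hasDerivAt.sub ((hasDerivAt_id z).mul_const _)).hasDerivWithinAt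
  have := (convex_closedBall (0 : ℂ) ‖t‖).norm_image_sub_le_of_norm_hasDerivWithin_le hder
    (C := 16 * M / R ^ 2 * ‖t‖) (fun z hz => by rw [one_mul]; exact hlip z hz)
    (x := 0) (y := t) (by simp) (by simp)
  simp only [zero_mul, sub_zero] at this
  rw [mul_assoc, ← sq] at this
  rwa [sub_right_comm]

theorem deriv_add_one_eq {f : ℂ → ℂ} {V : Set ℂ} (hV : IsOpen V) {a : ℂ}
    (h : ∀ z ∈ V, f (z + 1) = f z + a) {z : ℂ} (hz : z ∈ V) : deriv f (z + 1) = deriv f z := by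
  rw [← deriv_comp_add_const, ← deriv_add_const (f := f) a]
  refine EventuallyEq.deriv_eq ?_
  filter_upwards [hV.mem_nhds hz] with w hw using h w hw

theorem norm_le_of_mem_reProdIm {z : ℂ} {σ : ℝ} (h : z ∈ Set.Icc (0 : ℝ) 1 ×ℂ Set.Icc (-σ) σ) :
    ‖z‖ ≤ 1 + σ := by
  rw [Complex.mem_reProdIm] at h
  refine (Complex.norm_le_abs_re_add_abs_im z).trans (add_le_add ?_ (abs_le.2 h.2))
  rw [abs_of_nonneg h.1.1]; exact h.1.2

/-- A Herman ring conjugates the family `F + t` to a holomorphic family of perturbations of the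
rotation. -/
theorem IsLinearizingMap.exists_isRotationPerturbation {F : CircleDeg1Lift} {Φ : ℝ → ℝ}
    (hΦ : IsLinearizingMap F Φ) (hbij : Function.Bijective Φ) {Ψ : ℂ → ℂ} {σ σ₀ : ℝ} (hσ : 0 < σ)
    (hσσ₀ : σ < σ₀) (hΨd : DifferentiableOn ℂ Ψ (horizontalStrip σ₀))
    (hΨi : Set.InjOn Ψ (horizontalStrip σ₀)) (hΨ : ∀ x : ℝ, Ψ (Φ x : ℂ) = x) :
    ∃ (r B c M : ℝ) (g : ℂ × ℂ → ℂ) (h : ℂ → ℂ),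
      IsRotationPerturbation F.translationNumber σ r B c g h ∧ 0 < M ∧
      (∀ x t : ℝ, (Φ x : ℂ) + F.translationNumber + g (Φ x, t) = Φ (F x + t)) ∧
      ∀ x y : ℝ, x ≤ y → y - x ≤ M * (Φ y - Φ x) := by
  set θ := F.translationNumber
  have hσ₀ : 0 < σ₀ := hσ.trans hσσ₀
  have hS₀ := isOpen_horizontalStrip σ₀
  have hpre : IsPreconnected (horizontalStrip σ₀) := (convex_horizontalStrip σ₀).isPreconnected
  have hsh : ∀ {s : ℝ} {z : ℂ}, z ∈ horizontalStrip s → ∀ n : ℤ, z + n ∈ horizontalStrip s := by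
    intro s z hz n
    simpa using add_ofReal_mem_horizontalStrip hz n
  have hθs : ∀ {s : ℝ} {z : ℂ}, z ∈ horizontalStrip s → z + θ ∈ horizontalStrip s := fun hz =>
    add_ofReal_mem_horizontalStrip hz θ
  -- The relation holds on the real line because `Φ` is onto and commutes with the unit translation;
  -- the identity theorem extends it to the strip.
  have hΨ1 : ∀ z ∈ horizontalStrip σ₀, Ψ (z + 1) = Ψ z + 1 := by
    have ha : AnalyticOnNhd ℂ Ψ (horizontalStrip σ₀) := hΨd.analyticOnNhd hS₀
    have ha1 : AnalyticOnNhd ℂ (fun z => Ψ (z + 1)) (horizontalStrip σ₀) :=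
      (hΨd.comp (by fun_prop) fun z hz => by simpa using hsh hz 1).analyticOnNhd hS₀
    have ha2 : AnalyticOnNhd ℂ (fun z => Ψ z + 1) (horizontalStrip σ₀) :=
      (hΨd.add_const 1).analyticOnNhd hS₀
    refine ha1.eqOn_of_preconnected_of_frequently_eq ha2 hpre
      (ofReal_mem_horizontalStrip hσ₀ 0) ?_
    have ht : Tendsto (fun x : ℝ => (x : ℂ)) (𝓝[≠] 0) (𝓝[≠] ((0 : ℝ) : ℂ)) := by
      refine tendsto_nhdsWithin_iff.2 ⟨?_, ?_⟩
      · exact (Complex.continuous_ofReal.tendsto 0).mono_left nhdsWithin_le_nhds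
      · filter_upwards [self_mem_nhdsWithin] with x hx
        simpa using hx
    refine ht.frequently (Eventually.frequently (Eventually.of_forall fun y => ?_))
    obtain ⟨x, rfl⟩ := hbij.2 y
    have := hΨ (x + 1)
    rw [hΦ.map_add_one] at this
    push_cast at this
    rw [this, hΨ x]
  have hΨn : ∀ z ∈ horizontalStrip σ₀, ∀ n : ℤ, Ψ (z + n) = Ψ z + n := by
    intro z hz n
    induction n with
    | zero => simp
    | succ n ih =>
      have := hΨ1 (z + (n : ℤ)) (hsh hz n)
      push_cast at this ih ⊢
      rw [← add_assoc, this, ih]; ring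
    | pred n ih =>
      have := hΨ1 (z + (-n - 1 : ℤ)) (hsh hz _)
      have e : z + ((-n - 1 : ℤ) : ℂ) + 1 = z + ((-n : ℤ) : ℂ) := by push_cast; ring
      rw [e, ih] at this
      push_cast at this ⊢
      linear_combination -this
  obtain ⟨hUo, G, hGd, hG⟩ := exists_differentiableOn_leftInverse hS₀ hpre hΨd hΨi
  set U := Ψ '' horizontalStrip σ₀ with hU
  have hUn : ∀ v ∈ U, ∀ n : ℤ, v + n ∈ U ∧ G (v + n) = G v + n := by
    rintro _ ⟨z, hz, rfl⟩ n
    rw [← hΨn z hz n]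
    exact ⟨⟨_, hsh hz n, rfl⟩, by rw [hG _ (hsh hz n), hG z hz]⟩
  have hGr : ∀ x : ℝ, G x = Φ x := by
    intro x
    rw [← hΨ x, hG _ (ofReal_mem_horizontalStrip hσ₀ _)]
  have hG'1 : ∀ v ∈ U, deriv G (v + 1) = deriv G v := fun v hv =>
    deriv_add_one_eq (a := 1) hUo (fun z hz => by simpa using (hUn z hz 1).2) hv
  have hGd' : DifferentiableOn ℂ (deriv G) U := hGd.deriv hUo
  -- uniform bounds near the image of the closed strip
  have hrect : IsCompact (Set.Icc (0 : ℝ) 1 ×ℂ Set.Icc (-σ) σ) :=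
    isCompact_Icc.reProdIm isCompact_Icc
  have hrectsub : Set.Icc (0 : ℝ) 1 ×ℂ Set.Icc (-σ) σ ⊆ horizontalStrip σ₀ := by
    intro z hz
    rw [Complex.mem_reProdIm] at hz
    exact lt_of_le_of_lt (abs_le.2 hz.2) hσσ₀
  have hK : IsCompact (Ψ '' (Set.Icc (0 : ℝ) 1 ×ℂ Set.Icc (-σ) σ)) :=
    hrect.image_of_continuousOn (hΨd.continuousOn.mono hrectsub)
  obtain ⟨R, hR, hRU⟩ := hK.exists_cthickening_subset_open hUo (Set.image_mono hrectsub)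
  obtain ⟨M₁, hM₁⟩ := hK.cthickening.exists_bound_of_continuousOn (hGd.continuousOn.mono hRU)
  -- An integer translation brings $w$ into the compact rectangle, where a uniform $R$ is available;
  -- `Ψ` and `G` commute with that translation.
  have hnear : ∀ w ∈ horizontalStrip σ, ∀ t : ℂ, ‖t‖ ≤ R →
      Ψ w + t ∈ U ∧ ‖G (Ψ w + t) - w‖ ≤ M₁ + (1 + σ) := by
    intro w hw t ht
    have hw₀ : w + (-⌊w.re⌋ : ℤ) ∈ Set.Icc (0 : ℝ) 1 ×ℂ Set.Icc (-σ) σ := by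
      rw [Complex.mem_reProdIm]
      have hw' := abs_lt.1 (mem_horizontalStrip.1 hw)
      refine ⟨⟨?_, ?_⟩, ?_, ?_⟩
      · simpa using Int.floor_le w.re
      · simp; linarith [Int.lt_floor_add_one w.re]
      · simpa using hw'.1.le
      · simpa using hw'.2.le
    set w₀ := w + (-⌊w.re⌋ : ℤ) with hw₀'
    have hmem : Ψ w₀ + t ∈ Metric.cthickening R (Ψ '' (Set.Icc (0 : ℝ) 1 ×ℂ Set.Icc (-σ) σ)) :=
      Metric.mem_cthickening_of_dist_le _ (Ψ w₀) _ _ ⟨w₀, hw₀, rfl⟩ (by simpa using ht)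
    obtain ⟨h1, h2⟩ := hUn _ (hRU hmem) ⌊w.re⌋
    have e : Ψ w + t = Ψ w₀ + t + ⌊w.re⌋ := by
      rw [hw₀', hΨn w (horizontalStrip_mono hσσ₀.le hw)]; push_cast; ring
    rw [e]
    refine ⟨h1, ?_⟩
    have e2 : Ψ w₀ + t + ⌊w.re⌋ = Ψ w₀ + t + (⌊w.re⌋ : ℤ) := rfl
    have e3 : G (Ψ w₀ + t + ⌊w.re⌋) - w = G (Ψ w₀ + t) - w₀ := by
      rw [h2, hw₀']; push_cast; ring
    rw [e3]
    exact (norm_sub_le _ _).trans (add_le_add (hM₁ _ hmem) (norm_le_of_mem_reProdIm hw₀))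
  set M₂ := M₁ + (1 + σ) with hM₂
  have hM₂0 : 0 ≤ M₂ := (norm_nonneg _).trans
    (hnear 0 (by simpa using ofReal_mem_horizontalStrip hσ 0) 0 (by simpa using hR.le)).2
  -- $F\circ\Psi=\Psi(\cdot+\theta)$ on the real line, so `Ψ (w + θ) + t` stands for $F(\Psi(w))+t$
  -- and no complex extension of $F$ is needed.
  let g : ℂ × ℂ → ℂ := fun z => G (Ψ (z.1 + θ) + z.2) - (z.1 + θ)
  let h : ℂ → ℂ := fun w => deriv G (Ψ (w + θ))
  have hhd : DifferentiableOn ℂ h (horizontalStrip σ₀) :=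
    hGd'.comp (hΨd.comp (by fun_prop) fun z hz => hθs hz) fun z hz => ⟨_, hθs hz, rfl⟩
  have hh1 : ∀ w ∈ horizontalStrip σ₀, h (w + 1) = h w := by
    intro w hw
    simp only [h]
    rw [add_right_comm, hΨ1 _ (hθs hw), hG'1 _ ⟨_, hθs hw, rfl⟩]
  obtain ⟨L, hL0, hL⟩ := exists_bound_of_periodic hσσ₀ (hhd.deriv hS₀).continuousOn
    fun z hz => deriv_add_one_eq (a := 0) hS₀ (fun z hz => by rw [hh1 z hz, add_zero]) hz
  obtain ⟨M, hM0, hM⟩ := exists_bound_of_periodic hσσ₀ (hΨd.deriv hS₀).continuousOn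
    fun z hz => deriv_add_one_eq (a := 1) hS₀ hΨ1 hz
  have hexp : ∀ x y : ℝ, x ≤ y → y - x ≤ M * (Φ y - Φ x) := by
    intro x y hxy
    have := (convex_horizontalStrip σ).norm_image_sub_le_of_norm_deriv_le (𝕜 := ℂ) (f := Ψ) (C := M)
      (fun z hz => hΨd.differentiableAt (hS₀.mem_nhds (horizontalStrip_mono hσσ₀.le hz))) hM
      (ofReal_mem_horizontalStrip hσ (Φ x)) (ofReal_mem_horizontalStrip hσ (Φ y))
    rw [hΨ, hΨ, ← Complex.ofReal_sub, ← Complex.ofReal_sub, Complex.norm_real, Complex.norm_real,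
      Real.norm_of_nonneg (sub_nonneg.2 hxy), Real.norm_of_nonneg (sub_nonneg.2 (hΦ.monotone hxy))]
      at this
    exact this
  have hslice : ∀ w ∈ horizontalStrip σ, ∀ t : ℂ, ‖t‖ ≤ R / 4 →
      ‖h w‖ ≤ 4 * M₂ / R ∧ ‖g (w, t) - t * h w‖ ≤ 16 * M₂ / R ^ 2 * ‖t‖ ^ 2 := by
    intro w hw t ht
    have hwθ := hθs hw
    have hd : DifferentiableOn ℂ (fun t => g (w, t)) (Metric.ball 0 R) := by
      have hlin : DifferentiableOn ℂ (fun t => Ψ (w + θ) + t) (Metric.ball 0 R) := by fun_prop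
      refine (hGd.comp hlin fun t ht => ?_).sub_const (w + θ)
      exact (hnear _ hwθ t (by simpa using (mem_ball_zero_iff.1 ht).le)).1
    have h1 := norm_sub_sub_mul_deriv_le hR hd (fun z hz => (hnear _ hwθ z hz.le).2) ht
    have e0 : g (w, 0) = 0 := by
      simp only [g]
      rw [add_zero, hG _ (horizontalStrip_mono hσσ₀.le hwθ), sub_self]
    have e1 : deriv (fun t => g (w, t)) 0 = h w := by
      simp only [g, h]
      rw [deriv_sub_const, deriv_comp_const_add, add_zero]
    rw [e0, e1, sub_zero] at h1
    exact h1
  set B := max (max (4 * M₂ / R) (16 * M₂ / R ^ 2)) L with hB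
  have hBL : L ≤ B := le_max_right _ _
  have hB1 : 4 * M₂ / R ≤ B := (le_max_left _ _).trans (le_max_left _ _)
  have hB2 : 16 * M₂ / R ^ 2 ≤ B := (le_max_right _ _).trans (le_max_left _ _)
  have hr4 : min (R / 4) 1 ≤ R / 4 := min_le_left _ _
  refine ⟨min (R / 4) 1, B, 1 / M, M, g, h, ?_, hM0, ?_, hexp⟩
  · refine
      { width_pos := hσ
        radius_pos := by positivity
        radius_le_one := min_le_right _ _
        bound_pos := hL0.trans_le hBL
        lower_pos := by positivity
        differentiableOn := ?_
        map_add_one := ?_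
        norm_sub_le := ?_
        differentiableOn_deriv := hhd.mono (horizontalStrip_mono hσσ₀.le)
        deriv_add_one := fun w hw => hh1 w (horizontalStrip_mono hσσ₀.le hw)
        norm_deriv_le := fun w hw => (hslice w hw 0 (by rw [norm_zero]; positivity)).1.trans hB1
        lipschitz_deriv := ?_
        le_re_deriv := ?_ }
    · refine DifferentiableOn.sub ?_ (by fun_prop)
      have hΨ2 : DifferentiableOn ℂ (fun z : ℂ × ℂ => Ψ (z.1 + θ))
          (horizontalStrip σ ×ˢ Metric.ball 0 (min (R / 4) 1)) :=
        hΨd.comp (by fun_prop) fun z hz => hθs (horizontalStrip_mono hσσ₀.le hz.1)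
      refine hGd.comp (hΨ2.add differentiableOn_snd) fun z hz => ?_
      refine (hnear _ (hθs hz.1) z.2 ?_).1
      have := mem_ball_zero_iff.1 hz.2
      linarith
    · intro w hw t ht
      have hwθ := hθs hw
      have h1 := (hUn _ (hnear _ hwθ t (by linarith)).1 1).2
      simp only [g]
      rw [add_right_comm, hΨ1 _ (horizontalStrip_mono hσσ₀.le hwθ), add_right_comm (Ψ _)]
      simp only [Int.cast_one] at h1
      rw [h1]; ring
    · intro w hw t ht
      refine (hslice w hw t (by linarith)).2.trans ?_
      gcongr
    · intro w hw w' hw'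
      refine ((convex_horizontalStrip σ).norm_image_sub_le_of_norm_deriv_le (𝕜 := ℂ) (f := h)
        (fun z hz => hhd.differentiableAt (hS₀.mem_nhds (horizontalStrip_mono hσσ₀.le hz))) hL
        hw' hw).trans ?_
      gcongr
    -- On the real line $h(x)=\Phi'(y)$ for a real $y$, and the expansion bound `hexp` keeps every
    -- difference quotient of `Φ` at least $1/M$.
    · intro x
      obtain ⟨y, hy⟩ := hbij.2 (x + θ)
      have e : Ψ ((x : ℂ) + θ) = y := by
        rw [← hΨ y, hy]; push_cast; rfl
      have hyU : (y : ℂ) ∈ U := ⟨_, ofReal_mem_horizontalStrip hσ₀ (Φ y), hΨ y⟩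
      have hd := (hGd.differentiableAt (hUo.mem_nhds hyU)).hasDerivAt.real_of_complex
      simp only [hGr, Complex.ofReal_re] at hd
      simp only [h]
      rw [e]
      refine ge_of_tendsto (hasDerivAt_iff_tendsto_slope.1 hd) ?_
      filter_upwards [self_mem_nhdsWithin] with s hs
      rw [slope_def_field]
      rcases lt_or_gt_of_ne hs with hlt | hlt
      · rw [← neg_div_neg_eq (Φ s - Φ y), neg_sub, neg_sub, div_le_div_iff₀ hM0 (by linarith)]
        linarith [hexp s y hlt.le]
      · rw [div_le_div_iff₀ hM0 (by linarith)]
        linarith [hexp y s hlt.le]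
  · intro x t
    simp only [g]
    have e : Ψ ((Φ x : ℂ) + θ) = F x := by
      rw [← hΨ (F x), hΦ.map_map]; push_cast; rfl
    rw [e, ← Complex.ofReal_add, ← Complex.ofReal_add, hGr]
    push_cast; ring

/-! ### Lengths of the parameter intervals -/

theorem translatedMap_apply (F : CircleDeg1Lift) (t x : ℝ) : translatedMap F t x = F x + t := rfl

theorem exists_iterate_eq_of_mem_paramInterval {F : CircleDeg1Lift} (hF : Continuous F) {p : ℤ}
    {q : ℕ} (hq : 0 < q) {t : ℝ} (ht : t ∈ paramInterval F (p / q)) :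
    ∃ x, (translatedMap F t)^[q] x = x + p := by
  have hc : Continuous (translatedMap F t) := hF.add continuous_const
  obtain ⟨x, hx⟩ := ((translatedMap F t).translationNumber_eq_rat_iff hc hq).1 ht
  exact ⟨x, by rwa [CircleDeg1Lift.coe_pow] at hx⟩

/-- A closed orbit of rotation number `p / q` only occurs for parameters comparable to
`|θ - p / q|`. -/
theorem IsLinearizingMap.abs_le_of_iterate_eq {F : CircleDeg1Lift} {Φ : ℝ → ℝ}
    (hΦ : IsLinearizingMap F Φ) {M : ℝ} (hM : 0 < M)
    (hexp : ∀ x y : ℝ, x ≤ y → y - x ≤ M * (Φ y - Φ x)) {p : ℤ} {q : ℕ} (hq : 0 < q) {t x : ℝ}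
    (hx : (translatedMap F t)^[q] x = x + p) : |t| ≤ M * |F.translationNumber - p / q| := by
  set θ := F.translationNumber
  have hq' : (0 : ℝ) < q := by exact_mod_cast hq
  have hp := hΦ.map_add_int x p
  rcases le_total 0 t with ht | ht
  -- In the coordinate `Φ` each step advances by at least $\theta+t/M$, whereas $q$ steps advance by
  -- exactly $p$. For $t\le0$ the inequality is reversed.
  · have hstep : ∀ k : ℕ, k * (M * θ + t) ≤ M * (Φ ((translatedMap F t)^[k] x) - Φ x) := by
      intro k
      induction k with
      | zero => simp
      | succ k ih =>
        rw [Function.iterate_succ_apply', translatedMap_apply]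
        set y := (translatedMap F t)^[k] x
        have h1 := hexp (F y) (F y + t) (by linarith)
        rw [hΦ.map_map] at h1
        push_cast
        linarith
    have h1 := hstep q
    rw [hx, hp] at h1
    have h2 : t ≤ M * (p / q - θ) := by
      have : q * t ≤ q * (M * (p / q - θ)) := by
        have e : (q : ℝ) * (M * (p / q - θ)) = M * (p - q * θ) := by field_simp
        rw [e]; linarith
      exact le_of_mul_le_mul_left this hq'
    rw [abs_of_nonneg ht, abs_sub_comm]
    exact h2.trans (by gcongr; exact le_abs_self _)
  · have hstep : ∀ k : ℕ, M * (Φ ((translatedMap F t)^[k] x) - Φ x) ≤ k * (M * θ + t) := by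
      intro k
      induction k with
      | zero => simp
      | succ k ih =>
        rw [Function.iterate_succ_apply', translatedMap_apply]
        set y := (translatedMap F t)^[k] x
        have h1 := hexp (F y + t) (F y) (by linarith)
        rw [hΦ.map_map] at h1
        push_cast
        linarith
    have h1 := hstep q
    rw [hx, hp] at h1
    have h2 : -t ≤ M * (θ - p / q) := by
      have : q * -t ≤ q * (M * (θ - p / q)) := by
        have e : (q : ℝ) * (M * (θ - p / q)) = M * (q * θ - p) := by field_simp
        rw [e]; linarith
      exact le_of_mul_le_mul_left this hq'
    rw [abs_of_nonpos ht]
    exact h2.trans (by gcongr; exact le_abs_self _)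

theorem horizontalStrip_subset_openStrip {σ : ℝ} {τ : ℝ≥0∞} (hσ : 0 < σ)
    (h : ENNReal.ofReal σ ≤ τ) : horizontalStrip σ ⊆ openStrip τ := by
  intro z hz
  exact lt_of_lt_of_le ((ENNReal.ofReal_lt_ofReal_iff hσ).2 hz) h

/-- The lengths of the parameter intervals decay exponentially with any rate less than the one
given by the modulus of the Herman ring. -/
theorem exists_paramLength_le {F : CircleDeg1Lift} (hF : Continuous F)
    (hirr : Irrational F.translationNumber) {τ : ℝ≥0∞} (hring : hermanModulus F = 2 * τ) {σ : ℝ}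
    (hσ : 0 < σ) (hστ : ENNReal.ofReal σ < τ) :
    ∃ C : ℝ, 0 < C ∧ ∀ᶠ n : ℕ in atTop,
      paramLength F ((F.translationNumber.convergent n : ℚ) : ℝ) ≤ ENNReal.ofReal
        (C * Real.exp (-(2 * Real.pi * ((F.translationNumber.convergent n).den * σ)))) := by
  set θ := F.translationNumber
  obtain ⟨σ₀, hσ₀, hσσ₀, hσ₀τ⟩ : ∃ σ₀ : ℝ, 0 < σ₀ ∧ σ < σ₀ ∧ ENNReal.ofReal σ₀ < τ := by
    obtain ⟨s, hs1, hs2⟩ := ENNReal.lt_iff_exists_real_btwn.1 hστ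
    exact ⟨s, hσ.trans ((ENNReal.ofReal_lt_ofReal_iff_of_nonneg hσ.le).1 hs2.1),
      (ENNReal.ofReal_lt_ofReal_iff_of_nonneg hσ.le).1 hs2.1, hs2.2⟩
  have hsup : sSup {τ : ℝ≥0∞ | InverseExtendsUnivalently F τ} = τ :=
    (ENNReal.mul_right_inj two_ne_zero ENNReal.ofNat_ne_top).1 hring
  rw [← hsup] at hσ₀τ
  obtain ⟨τ', ⟨Φ, hΦ, hbij, Ψ, hΨd, hΨi, hΨ⟩, hτ'⟩ := lt_sSup_iff.1 hσ₀τ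
  have hsub := horizontalStrip_subset_openStrip hσ₀ hτ'.le
  -- The gap from $\sigma_1$ to $\sigma_0$ gives compactness for the conjugated family; the gap from
  -- $\sigma$ to $\sigma_1$ is the $\delta$ lost in the closing argument.
  set σ₁ := (σ + σ₀) / 2 with hσ₁
  obtain ⟨r, B, c, M, g, h, H, hM, hstep, hexp⟩ := hΦ.exists_isRotationPerturbation hbij
    (σ := σ₁) (by linarith) (by linarith) (hΨd.mono hsub) (hΨi.mono hsub) hΨ
  obtain ⟨C, hC, hev⟩ := H.exists_forall_closing_parameter (δ := σ₁ - σ) (by linarith) (by linarith) M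
  refine ⟨2 * C, by positivity, ?_⟩
  filter_upwards [hirr.tendsto_convergent_den.eventually hev] with n hn
  set x₀ := θ.convergent n
  have hq : 0 < x₀.den := x₀.den_pos
  have hx₀ : (x₀ : ℝ) = x₀.num / x₀.den := Rat.cast_def x₀
  have happ := hirr.abs_sub_convergent_le n
  rw [hx₀] at happ
  obtain ⟨c₀, hc₀⟩ := hn x₀.num (Int.isCoprime_iff_gcd_eq_one.2 x₀.reduced) happ
  rw [sub_sub_cancel] at hc₀
  -- The centre $c_0$ may be complex; the parameters are real, so projecting to the real part keeps
  -- the bound.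
  have hsubset : paramInterval F x₀ ⊆
      Metric.closedBall c₀.re (C * Real.exp (-(2 * Real.pi * (x₀.den * σ)))) := by
    intro t ht
    rw [hx₀] at ht
    obtain ⟨x, hx⟩ := exists_iterate_eq_of_mem_paramInterval hF hq ht
    have htb := hΦ.abs_le_of_iterate_eq hM hexp hq hx
    have horb : ∀ k : ℕ, perturbedOrbit θ g t (Φ x) k = Φ ((translatedMap F t)^[k] x) := by
      intro k
      induction k with
      | zero => rfl
      | succ k ih =>
        rw [perturbedOrbit_succ, ih, Function.iterate_succ_apply', translatedMap_apply, hstep]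
    have h1 := hc₀ (Φ x) t ?_ ?_
    · rw [Metric.mem_closedBall, Real.dist_eq]
      refine le_trans ?_ h1
      simpa using Complex.abs_re_le_norm ((t : ℂ) - c₀)
    · rw [Complex.norm_real, Real.norm_eq_abs]
      refine htb.trans ?_
      rw [div_eq_mul_one_div M]
      gcongr
    · rw [horb, hx]
      rw [hΦ.map_add_int]; push_cast; rfl
  calc paramLength F x₀ ≤ _ := measure_mono hsubset
    _ = _ := by rw [Real.volume_closedBall]; congr 1; ring

/-- The constant $C$ contributes $\log C/q_n\to0$. -/
theorem limsup_mul_log_le {q : ℕ → ℕ} (hq : Tendsto q atTop atTop) {ℓ : ℕ → ℝ≥0∞} {C σ : ℝ}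
    (hC : 0 < C)
    (h : ∀ᶠ n in atTop, ℓ n ≤ ENNReal.ofReal (C * Real.exp (-(2 * Real.pi * (q n * σ))))) :
    limsup (fun n => ((1 / (q n : ℝ) : ℝ) : EReal) * ENNReal.log (ℓ n)) atTop
      ≤ ((-(2 * Real.pi * σ) : ℝ) : EReal) := by
  have hlim : Tendsto (fun n => ((Real.log C * (q n : ℝ)⁻¹ + -(2 * Real.pi * σ) : ℝ) : EReal)) atTop
      (𝓝 ((-(2 * Real.pi * σ) : ℝ) : EReal)) := by
    rw [EReal.tendsto_coe]
    have := ((tendsto_inv_atTop_nhds_zero_nat (𝕜 := ℝ)).comp hq).const_mul (Real.log C)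
    simpa using this.add_const (-(2 * Real.pi * σ))
  rw [← hlim.limsup_eq]
  refine limsup_le_limsup ?_
  filter_upwards [h, hq.eventually_gt_atTop 0] with n hn hqn
  have hqn' : (0 : ℝ) < q n := by exact_mod_cast hqn
  have h1 := ENNReal.log_monotone hn
  rw [ENNReal.log_ofReal_of_pos (by positivity), Real.log_mul hC.ne' (Real.exp_ne_zero _),
    Real.log_exp] at h1
  calc ((1 / (q n : ℝ) : ℝ) : EReal) * ENNReal.log (ℓ n)
      ≤ ((1 / (q n : ℝ) : ℝ) : EReal) * ((Real.log C + -(2 * Real.pi * (q n * σ)) : ℝ) : EReal) :=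
        mul_le_mul_of_nonneg_left h1 (EReal.coe_nonneg.2 (by positivity))
    _ = _ := by
        rw [← EReal.coe_mul]
        congr 1
        field_simp

theorem theorem1 (F : CircleDeg1Lift)
    (hF : ∀ x : ℝ, AnalyticAt ℝ F x) (hF' : ∀ x : ℝ, 0 < deriv F x)
    (θ : ℝ) (hθ : F.translationNumber = θ) (hirr : Irrational θ)
    (τ : ℝ≥0∞) (hτ : 0 < τ) (hring : hermanModulus F = 2 * τ) :
    limsup (fun n : ℕ =>
        ((1 / ((θ.convergent n).den : ℝ) : ℝ) : EReal)
          * ENNReal.log (paramLength F ((θ.convergent n : ℚ) : ℝ))) atTop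
      ≤ -(((2 * Real.pi : ℝ) : EReal) * (τ : EReal)) := by
  subst hθ
  have hcont : Continuous F := continuous_iff_continuousAt.2 fun x => (hF x).continuousAt
  have hpi : 0 < 2 * Real.pi := by positivity
  -- It suffices to bound the limsup by each real $z>-2\pi\tau$. This treats $\tau=\infty$ as well,
  -- where $\sigma$ may be arbitrarily large.
  refine EReal.le_of_forall_lt_iff_le.1 fun z hz => ?_
  obtain ⟨σ, hσ, hστ, hσz⟩ : ∃ σ : ℝ, 0 < σ ∧ ENNReal.ofReal σ < τ ∧ -(2 * Real.pi * σ) ≤ z := by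
    induction τ with
    | top =>
      refine ⟨max 1 (-z / (2 * Real.pi)), by positivity, ENNReal.ofReal_lt_top, ?_⟩
      have h1 := le_max_right 1 (-z / (2 * Real.pi))
      rw [div_le_iff₀ hpi] at h1
      linarith
    | coe τ =>
      have hτ' : (0 : ℝ) < τ := by exact_mod_cast hτ
      have hz' : -(2 * Real.pi * τ) < z := by
        rwa [EReal.coe_nnreal_eq_coe_real, ← EReal.coe_mul, ← EReal.coe_neg,
          EReal.coe_lt_coe_iff] at hz
      have hlt : max (τ / 2 : ℝ) (-z / (2 * Real.pi)) < τ := by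
        refine max_lt (by linarith) ?_
        rw [div_lt_iff₀ hpi]; linarith
      refine ⟨max (τ / 2 : ℝ) (-z / (2 * Real.pi)), lt_max_of_lt_left (by positivity), ?_, ?_⟩
      · rw [ENNReal.ofReal_lt_coe_iff (by positivity)]
        exact hlt
      · have h1 := le_max_right (τ / 2 : ℝ) (-z / (2 * Real.pi))
        rw [div_le_iff₀ hpi] at h1
        linarith
  obtain ⟨C, hC, hev⟩ := exists_paramLength_le hcont hirr hring hσ hστ
  exact (limsup_mul_log_le hirr.tendsto_convergent_den hC hev).trans (EReal.coe_le_coe hσz)
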